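/- Let $n\ge 0$ and index the rows and columns of $2^n\times 2^n$ complex matrices by the computational basis $\{0,1\}^n$. Let $\mathcal C_n$ be the $n$-qubit Clifford group, i.e. the (finite) group of unitaries generated by the Hadamard gates and phase gates $S=\mathrm{diag}(1,i)$ on each qubit and the CNOT gates on each ordered pair of distinct qubits. For a set $\mathcal S\subseteq\mathcal C_n$ and a matrix $M\in\mathbb C^{2^n\times2^n}$ consider the problem $$\min\Big\{\|\mathbf x\|_1^2 \;:\; \mathbf x\in\mathbb C^{\mathcal S},\ M=\sum_{C\in\mathcal S}x_C\,C\Big\}.$$ The stabilizer extent $\xi(M)$ is this minimum for $\mathcal S=\mathcal C_n$, and a decomposition attaining it is called optimal. For a finite group $G$ of invertible real-linear maps of $\mathbb C^{2^n\times 2^n}$, let $\Pi_G(M)=\frac1{|G|}\sum_{\phi\in G}\phi(M)$, let $\mathcal C_n^G=\{C\in\mathcal C_n:\phi(C)=C\text{ for all }\phi\in G\}$, and let the $G$-symmetric stabilizer extent $\xi_G(M)$ be the minimum above for $\mathcal S=\mathcal C_n^G$. Let $\mathcal K_n=\{\mathrm{id},\,M\mapsto M^*\}$ (entrywise complex conjugation),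 let $\mathcal Z_n=\{M\mapsto Z(z)MZ(z)^\dagger : z\in\mathbb Z_2^n\}$ with $Z(z)=Z^{z_1}\otimes\dots\otimes Z^{z_n}$ and $Z=\mathrm{diag}(1,-1)$, and let $\mathcal K_n\times\mathcal Z_n$ be the group generated by these two commuting groups. The sets $\mathcal C_n^G$ for these three groups are the real, the diagonal, and the real diagonal Clifford unitaries, respectively. **Theorem.** Let $G\in\{\mathcal K_n,\ \mathcal Z_n,\ \mathcal K_n\times\mathcal Z_n\}$ and let $U\in\mathbb C^{2^n\times 2^n}$ satisfy $U=\Pi_G(U)$. Then both minima $\xi(U)$ and $\xi_G(U)$ exist, and $$\xi(U)=\xi_G(U).$$ In particular, $U$ has an optimal decomposition $U=\sum_{C\in\mathcal C_n}x_C\,C$ in which $x_C\neq0$ only for $C\in\mathcal C_n^G$. -/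

import Mathlib

/-- Complex `2^n × 2^n` matrices, with rows and columns indexed by the computational basis states
`|x⟩`, `x ∈ (ℤ/2)^n`. -/
abbrev QMat (n : ℕ) : Type := Matrix (Fin n → ZMod 2) (Fin n → ZMod 2) ℂ

/-! ### The Clifford group -/

/-- The one-qubit Hadamard gate. -/
noncomputable def hadamard : Matrix (ZMod 2) (ZMod 2) ℂ :=
  Matrix.of fun a b => (-1 : ℂ) ^ (a.val * b.val) / (Real.sqrt 2 : ℂ)

/-- The one-qubit phase gate `S = diag(1, i)`. -/
noncomputable def phaseS : Matrix (ZMod 2) (ZMod 2) ℂ :=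
  Matrix.diagonal fun a => Complex.I ^ a.val

/-- The one-qubit gate `A` acting on qubit `j`, and the identity on all other qubits. -/
def onQubit {n : ℕ} (j : Fin n) (A : Matrix (ZMod 2) (ZMod 2) ℂ) : QMat n :=
  Matrix.of fun x y => if ∀ k, k ≠ j → x k = y k then A (x j) (y j) else 0

/-- The controlled-NOT gate with control `j` and target `k`:
it maps `|y⟩` to `|y'⟩`, where `y'` is `y` with its `k`-th bit replaced by `y k + y j`. -/
def cnot {n : ℕ} (j k : Fin n) : QMat n :=
  Matrix.of fun x y => if x = Function.update y k (y k + y j) then 1 else 0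

/-- The `n`-qubit Clifford group: the group of unitaries generated by the Hadamard and phase gates
on every qubit and the controlled-NOT gates on every ordered pair of distinct qubits. -/
noncomputable def cliffordGroup (n : ℕ) : Subgroup (Matrix.unitaryGroup (Fin n → ZMod 2) ℂ) :=
  Subgroup.closure
    {U | (∃ j : Fin n, (U : QMat n) = onQubit j hadamard) ∨
      (∃ j : Fin n, (U : QMat n) = onQubit j phaseS) ∨
      (∃ j k : Fin n, j ≠ k ∧ (U : QMat n) = cnot j k)}

/-- The Clifford unitaries as a set of matrices. -/
def cliffords (n : ℕ) : Set (QMat n) :=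
  {C | ∃ U ∈ cliffordGroup n, (U : QMat n) = C}

/-! ### Symmetry groups

Linear and antilinear maps of complex matrices are in particular `ℝ`-linear, so a symmetry group is
a subgroup of the group of invertible `ℝ`-linear maps. -/

/-- Entrywise complex conjugation `M ↦ M^*`. -/
noncomputable def conjMap (n : ℕ) : QMat n ≃ₗ[ℝ] QMat n :=
  Complex.conjAe.toLinearEquiv.mapMatrix

/-- The group `K_n = {id, (·)^*}` generated by complex conjugation. -/
noncomputable def conjugationGroup (n : ℕ) : Subgroup (QMat n ≃ₗ[ℝ] QMat n) :=
  Subgroup.zpowers (conjMap n)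

/-- The diagonal Pauli operator `Z(z) = Z^{z_1} ⊗ ⋯ ⊗ Z^{z_n}`. -/
def pauliZ {n : ℕ} (z : Fin n → ZMod 2) : QMat n :=
  Matrix.diagonal fun x => ∏ j, (-1 : ℂ) ^ ((z j).val * (x j).val)

theorem pauliZ_zero {n : ℕ} : pauliZ (0 : Fin n → ZMod 2) = 1 := by
  simp [pauliZ]

theorem pauliZ_add {n : ℕ} (z w : Fin n → ZMod 2) : pauliZ (z + w) = pauliZ z * pauliZ w := by
  have h : ∀ a b c : ZMod 2, (-1 : ℂ) ^ ((a + b).val * c.val) =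
      (-1) ^ (a.val * c.val) * (-1) ^ (b.val * c.val) := by
    intro a b c
    rw [← pow_add, ← Nat.add_mul, neg_one_pow_eq_pow_mod_two, Nat.mul_mod, ZMod.val_add,
      Nat.mod_mod, ← Nat.mul_mod, ← neg_one_pow_eq_pow_mod_two]
  simp only [pauliZ, Matrix.diagonal_mul_diagonal, Pi.add_apply, h, Finset.prod_mul_distrib]

theorem pauliZ_mul_self {n : ℕ} (z : Fin n → ZMod 2) : pauliZ z * pauliZ z = 1 := by
  rw [← pauliZ_add, show z + z = 0 from funext fun j => CharTwo.add_self_eq_zero (z j), pauliZ_zero]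

theorem pauliZ_conjTranspose {n : ℕ} (z : Fin n → ZMod 2) :
    (pauliZ z).conjTranspose = pauliZ z := by
  rw [pauliZ, Matrix.diagonal_conjTranspose]
  congr 1
  funext x
  simp

/-- The channel `M ↦ Z(z) M Z(z)†`. -/
def pauliZChannel {n : ℕ} (z : Fin n → ZMod 2) : QMat n ≃ₗ[ℝ] QMat n where
  toFun M := pauliZ z * M * (pauliZ z).conjTranspose
  invFun M := pauliZ z * M * (pauliZ z).conjTranspose
  map_add' M N := by rw [Matrix.mul_add, Matrix.add_mul]
  map_smul' c M := by simp
  left_inv M := by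
    simp only [pauliZ_conjTranspose]
    rw [← Matrix.mul_assoc, ← Matrix.mul_assoc, pauliZ_mul_self, Matrix.one_mul, Matrix.mul_assoc,
      pauliZ_mul_self, Matrix.mul_one]
  right_inv M := by
    simp only [pauliZ_conjTranspose]
    rw [← Matrix.mul_assoc, ← Matrix.mul_assoc, pauliZ_mul_self, Matrix.one_mul, Matrix.mul_assoc,
      pauliZ_mul_self, Matrix.mul_one]

/-- The diagonal Pauli group `Z_n`, acting by the channels `M ↦ Z(z) M Z(z)†`. -/
def diagonalPauliGroup (n : ℕ) : Subgroup (QMat n ≃ₗ[ℝ] QMat n) where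
  carrier := Set.range pauliZChannel
  mul_mem' := by
    rintro _ _ ⟨z, rfl⟩ ⟨w, rfl⟩
    refine ⟨z + w, LinearEquiv.ext fun M => ?_⟩
    change pauliZ (z + w) * M * (pauliZ (z + w)).conjTranspose =
      pauliZ z * (pauliZ w * M * (pauliZ w).conjTranspose) * (pauliZ z).conjTranspose
    rw [pauliZ_add, Matrix.conjTranspose_mul]
    simp only [Matrix.mul_assoc]
  one_mem' := by
    refine ⟨0, LinearEquiv.ext fun M => ?_⟩
    change pauliZ 0 * M * (pauliZ 0).conjTranspose = M
    simp [pauliZ_zero]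
  inv_mem' := by
    rintro _ ⟨z, rfl⟩
    exact ⟨z, rfl⟩

/-- The group `K_n × Z_n` generated by the commuting groups `K_n` and `Z_n`. -/
noncomputable def conjugationDiagonalPauliGroup (n : ℕ) : Subgroup (QMat n ≃ₗ[ℝ] QMat n) :=
  conjugationGroup n ⊔ diagonalPauliGroup n

/-- The projection `Π_G(M) = |G|⁻¹ ∑_{φ ∈ G} φ(M)` onto the `G`-invariant subspace, for a finite
group `G`. -/
noncomputable def groupProjection {n : ℕ} (G : Subgroup (QMat n ≃ₗ[ℝ] QMat n)) (M : QMat n) :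
    QMat n :=
  (Nat.card G : ℝ)⁻¹ • ∑ᶠ φ : G, (φ : QMat n ≃ₗ[ℝ] QMat n) M

/-- The set `C_n^G` of `G`-invariant Clifford unitaries. -/
def invariantCliffords {n : ℕ} (G : Subgroup (QMat n ≃ₗ[ℝ] QMat n)) : Set (QMat n) :=
  {C | C ∈ cliffords n ∧ ∀ φ ∈ G, φ C = C}

/-! ### Extents -/

/-- `x` is a decomposition `M = ∑_{C ∈ S} x_C C`. -/
def IsDecomposition {n : ℕ} {S : Set (QMat n)} (x : S →₀ ℂ) (M : QMat n) : Prop :=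
  M = x.sum fun C c => c • (C : QMat n)

/-- The squared `ℓ₁`-norm of the coefficients of a decomposition. -/
noncomputable def decompositionCost {n : ℕ} {S : Set (QMat n)} (x : S →₀ ℂ) : ℝ :=
  (x.sum fun _ c => ‖c‖) ^ 2

/-- The values over which the extent of `M` with respect to `S` is the minimum. -/
def costSet {n : ℕ} (S : Set (QMat n)) (M : QMat n) : Set ℝ :=
  {r | ∃ x : S →₀ ℂ, IsDecomposition x M ∧ decompositionCost x = r}

/-- The stabilizer extent `ξ(M)`. -/
noncomputable def stabilizerExtent {n : ℕ} (M : QMat n) : ℝ :=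
  sInf (costSet (cliffords n) M)

/-- The `G`-symmetric stabilizer extent `ξ_G(M)`. -/
noncomputable def symmetricExtent {n : ℕ} (G : Subgroup (QMat n ≃ₗ[ℝ] QMat n)) (M : QMat n) : ℝ :=
  sInf (costSet (invariantCliffords G) M)

/-!
Replacing an invariant `U` by its average over one symmetry does not change it, so it suffices that
the average of `c • C`, for a Clifford unitary `C`, is a combination of Clifford unitaries invariant
under that symmetry and under those treated before, with coefficients of `ℓ₁`-norm at most `‖c‖`.

For the channel of `Z = Z(z)`, put `P = Z C Z C†`, a Pauli operator, so that the average is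
`(c / 2) • (1 + P) C`. If `P ^ 2 = -1`, then `(1 + P) C` is up to a scalar the product of `C` with a
square root of the involution `i P`. If `P ^ 2 = 1` and `P ≠ 1`, symplectic duality yields a Pauli
involution `A` that anticommutes with `Z` and commutes with `P` and with the operators `Z(w)`
treated before. The controlled Pauli `V = ((1 + P) + (1 - P) A) / 2` satisfies `1 + P = V + P V`,
and both `V C` and `P V C` are invariant.

For an antiunitary symmetry `θ`, a phase makes `P = θ(C) C†` an involution; with a square root `R`
of `P`, both `R C` and `R P C` are invariant, and the average of `c • C` is their combination with
coefficients `(Re c ± Im c) / 2`.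
-/
section SignCharacter

theorem addChar_map_sum {ι A M : Type*} [AddCommMonoid A] [CommMonoid M] (ψ : AddChar A M)
    (s : Finset ι) (f : ι → A) : ψ (∑ i ∈ s, f i) = ∏ i ∈ s, ψ (f i) :=
  map_prod ψ.toMonoidHom (fun i => Multiplicative.ofAdd (f i)) s

theorem zmod_two_eq_zero_or_one (t : ZMod 2) : t = 0 ∨ t = 1 := by
  revert t; decide

/-- The nontrivial character `t ↦ (-1) ^ t` of `ZMod 2`. -/
noncomputable def signChar : AddChar (ZMod 2) ℂ :=
  AddChar.zmodChar 2 (ζ := -1) (by norm_num)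

@[simp] theorem signChar_one : signChar 1 = -1 := by
  simp [signChar, AddChar.zmodChar_apply, ZMod.val_one]

theorem signChar_mul (s t : ZMod 2) : signChar (s * t) = (-1) ^ (s.val * t.val) := by
  rcases zmod_two_eq_zero_or_one s with rfl | rfl <;>
    rcases zmod_two_eq_zero_or_one t with rfl | rfl <;> simp [ZMod.val_one]

theorem signChar_mul_self (t : ZMod 2) : signChar t * signChar t = 1 := by
  rw [← AddChar.map_add_eq_mul, CharTwo.add_self_eq_zero, AddChar.map_zero_eq_one]

theorem signChar_pow_four (t : ZMod 2) : signChar t ^ 4 = 1 := by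
  linear_combination (signChar t * signChar t + 1) * signChar_mul_self t

@[simp] theorem conj_signChar (t : ZMod 2) : (starRingEnd ℂ) (signChar t) = signChar t := by
  simp [signChar, AddChar.zmodChar_apply]

end SignCharacter

section Weyl

variable {n : ℕ}

theorem bits_add_self (a : Fin n → ZMod 2) : a + a = 0 :=
  funext fun k => CharTwo.add_self_eq_zero (a k)

/-- The Weyl operator `X^a Z^b`, that is `|y⟩ ↦ (-1) ^ (b ⬝ᵥ y) |y + a⟩`. -/
noncomputable def weyl (a b : Fin n → ZMod 2) : QMat n :=
  Matrix.of fun x y => if x = y + a then signChar (b ⬝ᵥ y) else 0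

theorem pauliZ_eq_weyl (z : Fin n → ZMod 2) : pauliZ z = weyl 0 z := by
  ext x y
  simp only [pauliZ, weyl, Matrix.diagonal_apply, Matrix.of_apply, add_zero]
  refine ite_congr rfl (fun h => ?_) fun _ => rfl
  simp only [h, dotProduct, addChar_map_sum, signChar_mul]

@[simp] theorem weyl_zero : weyl (0 : Fin n → ZMod 2) 0 = 1 := by
  rw [← pauliZ_eq_weyl, pauliZ_zero]

theorem weyl_mul (a b c d : Fin n → ZMod 2) :
    weyl a b * weyl c d = signChar (b ⬝ᵥ c) • weyl (a + c) (b + d) := by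
  ext x y
  have shift : x = y + c + a ↔ x = y + (a + c) := by rw [add_assoc, add_comm c a]
  simp only [weyl, Matrix.mul_apply, Matrix.of_apply, Matrix.smul_apply, smul_eq_mul, mul_ite,
    mul_zero, Finset.sum_ite_eq', Finset.mem_univ, if_true, shift, ite_mul, zero_mul]
  refine ite_congr rfl (fun _ => ?_) fun _ => rfl
  rw [← AddChar.map_add_eq_mul, ← AddChar.map_add_eq_mul, dotProduct_add, add_dotProduct]
  congr 1
  ring

theorem weyl_mul_self (a b : Fin n → ZMod 2) : weyl a b * weyl a b = signChar (b ⬝ᵥ a) • 1 := by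
  rw [weyl_mul, bits_add_self, bits_add_self, weyl_zero]

theorem weyl_mul_comm (a b c d : Fin n → ZMod 2) :
    weyl a b * weyl c d = signChar (b ⬝ᵥ c + a ⬝ᵥ d) • (weyl c d * weyl a b) := by
  rw [weyl_mul, weyl_mul, smul_smul, AddChar.map_add_eq_mul, add_comm c a, add_comm d b, mul_assoc,
    dotProduct_comm d a, signChar_mul_self, mul_one]

theorem conjMap_apply (M : QMat n) : conjMap n M = M.map (starRingEnd ℂ) := rfl

theorem conjMap_mul (M N : QMat n) : conjMap n (M * N) = conjMap n M * conjMap n N := by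
  simp only [conjMap_apply, Matrix.map_mul]

@[simp] theorem conjMap_one : conjMap n 1 = 1 := by
  rw [conjMap_apply, Matrix.map_one _ (map_zero _) (map_one _)]

theorem conjMap_smul (c : ℂ) (M : QMat n) :
    conjMap n (c • M) = (starRingEnd ℂ) c • conjMap n M := by
  ext x y
  simp [conjMap_apply]

@[simp] theorem conjMap_weyl (a b : Fin n → ZMod 2) : conjMap n (weyl a b) = weyl a b := by
  ext x y
  simp only [conjMap_apply, weyl, Matrix.map_apply, Matrix.of_apply, apply_ite (starRingEnd ℂ),
    conj_signChar, map_zero]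

end Weyl

section TensorProduct

variable {n : ℕ}

/-- The tensor product of a family of one-qubit operators, as a monoid homomorphism. -/
noncomputable def tensorMat : (Fin n → Matrix (ZMod 2) (ZMod 2) ℂ) →* QMat n where
  toFun M := Matrix.of fun x y => ∏ k, M k (x k) (y k)
  map_one' := by
    ext x y
    simp only [Matrix.of_apply, Pi.one_apply, Matrix.one_apply, Fintype.prod_ite_zero, funext_iff,
      Finset.prod_const_one]
  map_mul' M N := by
    ext x y
    simp only [Matrix.mul_apply, Matrix.of_apply, Pi.mul_apply, Finset.prod_univ_sum,
      Fintype.piFinset_univ, Finset.prod_mul_distrib]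

theorem tensorMat_apply (M : Fin n → Matrix (ZMod 2) (ZMod 2) ℂ) (x y : Fin n → ZMod 2) :
    tensorMat M x y = ∏ k, M k (x k) (y k) := rfl

theorem tensorMat_smul (c : Fin n → ℂ) (M : Fin n → Matrix (ZMod 2) (ZMod 2) ℂ) :
    tensorMat (fun k => c k • M k) = (∏ k, c k) • tensorMat M := by
  ext x y
  simp only [tensorMat_apply, Matrix.smul_apply, smul_eq_mul, Finset.prod_mul_distrib]

theorem onQubit_eq_tensorMat (j : Fin n) (A : Matrix (ZMod 2) (ZMod 2) ℂ) :
    onQubit j A = tensorMat (Pi.mulSingle j A) := by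
  ext x y
  rw [tensorMat_apply, ← Finset.mul_prod_erase _ _ (Finset.mem_univ j), Pi.mulSingle_eq_same]
  have off : ∏ k ∈ Finset.univ.erase j, (Pi.mulSingle j A : Fin n → _) k (x k) (y k) =
      ∏ k ∈ Finset.univ.erase j, if x k = y k then (1 : ℂ) else 0 :=
    Finset.prod_congr rfl fun k hk => by
      rw [Pi.mulSingle_eq_of_ne (Finset.ne_of_mem_erase hk), Matrix.one_apply]
  rw [off, Finset.prod_ite_zero]
  simp [onQubit]

theorem onQubit_one (j : Fin n) : onQubit j 1 = 1 := by
  rw [onQubit_eq_tensorMat, Pi.mulSingle_one, map_one]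

theorem onQubit_mul (j : Fin n) (A B : Matrix (ZMod 2) (ZMod 2) ℂ) :
    onQubit j (A * B) = onQubit j A * onQubit j B := by
  rw [onQubit_eq_tensorMat, Pi.mulSingle_mul, map_mul, ← onQubit_eq_tensorMat,
    ← onQubit_eq_tensorMat]

theorem onQubit_pow (j : Fin n) (A : Matrix (ZMod 2) (ZMod 2) ℂ) (k : ℕ) :
    onQubit j (A ^ k) = onQubit j A ^ k := by
  rw [onQubit_eq_tensorMat, Pi.mulSingle_pow, map_pow, ← onQubit_eq_tensorMat]

theorem onQubit_add (j : Fin n) (A B : Matrix (ZMod 2) (ZMod 2) ℂ) :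
    onQubit j (A + B) = onQubit j A + onQubit j B := by
  ext x y
  simp only [onQubit, Matrix.of_apply, Matrix.add_apply]
  split_ifs <;> simp

theorem onQubit_smul (j : Fin n) (c : ℂ) (A : Matrix (ZMod 2) (ZMod 2) ℂ) :
    onQubit j (c • A) = c • onQubit j A := by
  ext x y
  simp [onQubit]

theorem onQubit_conjTranspose (j : Fin n) (A : Matrix (ZMod 2) (ZMod 2) ℂ) :
    (onQubit j A).conjTranspose = onQubit j A.conjTranspose := by
  ext x y
  simp only [onQubit, Matrix.conjTranspose_apply, Matrix.of_apply, apply_ite star, star_zero,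
    @eq_comm _ (x _) (y _)]

theorem conjMap_onQubit (j : Fin n) (A : Matrix (ZMod 2) (ZMod 2) ℂ) :
    conjMap n (onQubit j A) = onQubit j (A.map (starRingEnd ℂ)) := by
  ext x y
  simp only [conjMap_apply, onQubit, Matrix.map_apply, Matrix.of_apply, apply_ite (starRingEnd ℂ),
    map_zero]

/-- The one-qubit Weyl operator `X^a Z^b`. -/
noncomputable def weylOne (a b : ZMod 2) : Matrix (ZMod 2) (ZMod 2) ℂ :=
  Matrix.of fun x y => if x = y + a then signChar (b * y) else 0

@[simp] theorem weylOne_zero : weylOne 0 0 = 1 := by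
  ext x y
  simp [weylOne, Matrix.one_apply]

theorem weyl_eq_tensorMat (a b : Fin n → ZMod 2) :
    weyl a b = tensorMat fun k => weylOne (a k) (b k) := by
  ext x y
  simp only [weyl, tensorMat_apply, weylOne, Matrix.of_apply, Fintype.prod_ite_zero, funext_iff,
    Pi.add_apply, dotProduct, addChar_map_sum]
  congr

theorem weyl_zero_single (j : Fin n) :
    weyl 0 (Pi.single j 1) = onQubit j (weylOne 0 1) := by
  rw [onQubit_eq_tensorMat, weyl_eq_tensorMat]
  congr 1
  funext k
  rcases eq_or_ne k j with rfl | hk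
  · simp
  · simp [hk]

theorem onQubit_mul_weyl {j : Fin n} {A : Matrix (ZMod 2) (ZMod 2) ℂ} {a b : Fin n → ZMod 2}
    {s t : ZMod 2} {c : ℂ} (h : A * weylOne (a j) (b j) = c • (weylOne s t * A)) :
    onQubit j A * weyl a b =
      c • (weyl (Function.update a j s) (Function.update b j t) * onQubit j A) := by
  have hc : c = ∏ k, (Pi.mulSingle j c : Fin n → ℂ) k := by simp
  rw [weyl_eq_tensorMat, weyl_eq_tensorMat, onQubit_eq_tensorMat, ← map_mul, ← map_mul, hc,
    ← tensorMat_smul]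
  congr 1
  funext k
  rcases eq_or_ne k j with rfl | hk
  · simp [h]
  · simp [hk]

end TensorProduct

section OneQubitGates

theorem matrix_zmod_two_ext {A B : Matrix (ZMod 2) (ZMod 2) ℂ} (h00 : A 0 0 = B 0 0)
    (h01 : A 0 1 = B 0 1) (h10 : A 1 0 = B 1 0) (h11 : A 1 1 = B 1 1) : A = B := by
  ext x y
  rcases zmod_two_eq_zero_or_one x with rfl | rfl <;>
    rcases zmod_two_eq_zero_or_one y with rfl | rfl <;> assumption

theorem sum_zmod_two (f : ZMod 2 → ℂ) : ∑ t, f t = f 0 + f 1 := Fin.sum_univ_two f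

theorem complex_sqrt_two_sq : (Real.sqrt 2 : ℂ) ^ 2 = 2 := by
  exact_mod_cast Real.sq_sqrt zero_le_two

theorem complex_sqrt_two_ne_zero : (Real.sqrt 2 : ℂ) ≠ 0 := by
  simp

theorem hadamard_mul_weylOne (a b : ZMod 2) :
    hadamard * weylOne a b = signChar (a * b) • (weylOne b a * hadamard) := by
  rcases zmod_two_eq_zero_or_one a with rfl | rfl <;>
    rcases zmod_two_eq_zero_or_one b with rfl | rfl <;>
    apply matrix_zmod_two_ext <;>
    simp [hadamard, weylOne, Matrix.mul_apply, sum_zmod_two, ZMod.val_one,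
      CharTwo.add_self_eq_zero] <;>
    ring

theorem phaseS_mul_weylOne (a b : ZMod 2) :
    phaseS * weylOne a b = Complex.I ^ a.val • (weylOne a (b + a) * phaseS) := by
  rcases zmod_two_eq_zero_or_one a with rfl | rfl <;>
    rcases zmod_two_eq_zero_or_one b with rfl | rfl <;>
    apply matrix_zmod_two_ext <;>
    simp [phaseS, weylOne, Matrix.mul_apply, ZMod.val_one, Matrix.diagonal_apply,
      CharTwo.add_self_eq_zero]

theorem hadamard_mul_self : hadamard * hadamard = 1 := by
  apply matrix_zmod_two_ext <;>
    simp [hadamard, Matrix.mul_apply, sum_zmod_two, ZMod.val_one] <;>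
    field_simp [complex_sqrt_two_ne_zero] <;> rw [complex_sqrt_two_sq] <;> norm_num

theorem hadamard_conjTranspose : hadamard.conjTranspose = hadamard := by
  apply matrix_zmod_two_ext <;> simp [hadamard, ZMod.val_one]

theorem hadamard_map_conj : hadamard.map (starRingEnd ℂ) = hadamard := by
  apply matrix_zmod_two_ext <;> simp [hadamard, ZMod.val_one]

theorem phaseS_mul_conjTranspose : phaseS * phaseS.conjTranspose = 1 := by
  apply matrix_zmod_two_ext <;>
    simp [phaseS, Matrix.mul_apply, ZMod.val_one, Matrix.diagonal_apply]

theorem phaseS_pow_four : phaseS ^ 4 = 1 := by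
  rw [phaseS, Matrix.diagonal_pow, ← Matrix.diagonal_one]
  congr 1
  funext a
  rw [Pi.pow_apply, pow_right_comm, Complex.I_pow_four, one_pow]

theorem phaseS_map_conj : phaseS.map (starRingEnd ℂ) = weylOne 0 1 * phaseS := by
  apply matrix_zmod_two_ext <;>
    simp [phaseS, weylOne, Matrix.mul_apply, ZMod.val_one, Matrix.diagonal_apply]

/-- The primitive eighth root of unity `(1 + i) / √2`, a square root of `i`. -/
noncomputable def omegaEight : ℂ := (1 + Complex.I) / (Real.sqrt 2 : ℂ)

theorem omegaEight_sq : omegaEight ^ 2 = Complex.I := by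
  rw [omegaEight, div_pow, complex_sqrt_two_sq]
  linear_combination (1 / 2 : ℂ) * Complex.I_sq

theorem norm_omegaEight : ‖omegaEight‖ = 1 := by
  have h : ‖omegaEight‖ ^ 2 = 1 := by rw [← norm_pow, omegaEight_sq, Complex.norm_I]
  exact (pow_eq_one_iff_of_nonneg (norm_nonneg _) two_ne_zero).1 h

theorem hadamard_mul_phaseS_pow_three : (hadamard * phaseS) ^ 3 = omegaEight • 1 := by
  have h2 := complex_sqrt_two_sq
  have hI := Complex.I_sq
  have h0 := complex_sqrt_two_ne_zero
  rw [pow_succ, sq]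
  apply matrix_zmod_two_ext <;>
    simp [hadamard, phaseS, omegaEight, Matrix.mul_apply, sum_zmod_two, ZMod.val_one,
      Matrix.diagonal_apply] <;> field_simp <;> grind

end OneQubitGates

section ControlledNot

variable {n : ℕ} {j k : Fin n}

theorem cnot_apply (j k : Fin n) (x y : Fin n → ZMod 2) :
    cnot j k x y = if x = y + Pi.single k (y j) then 1 else 0 := by
  have flip : Function.update y k (y k + y j) = y + Pi.single k (y j) := by
    funext l
    rcases eq_or_ne l k with rfl | h <;> simp [*]
  simp only [cnot, Matrix.of_apply, flip]

theorem eq_add_single_comm (h : j ≠ k) (x y : Fin n → ZMod 2) :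
    x = y + Pi.single k (y j) ↔ y = x + Pi.single k (x j) := by
  have key : ∀ x y : Fin n → ZMod 2, x = y + Pi.single k (y j) → y = x + Pi.single k (x j) := by
    rintro _ y rfl
    simp [Pi.single_eq_of_ne h, add_assoc, bits_add_self]
  exact ⟨key x y, key y x⟩

theorem cnot_conjTranspose (h : j ≠ k) : (cnot j k).conjTranspose = cnot j k := by
  ext x y
  simp only [Matrix.conjTranspose_apply, cnot_apply, eq_add_single_comm h y x, apply_ite star,
    star_one, star_zero]

theorem conjMap_cnot (j k : Fin n) : conjMap n (cnot j k) = cnot j k := by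
  ext x y
  simp only [conjMap_apply, Matrix.map_apply, cnot_apply, apply_ite (starRingEnd ℂ), map_one,
    map_zero]

theorem cnot_mul_apply (h : j ≠ k) (M : QMat n) (x y : Fin n → ZMod 2) :
    (cnot j k * M) x y = M (x + Pi.single k (x j)) y := by
  simp [Matrix.mul_apply, cnot_apply, eq_add_single_comm h x]

theorem mul_cnot_apply (j k : Fin n) (M : QMat n) (x y : Fin n → ZMod 2) :
    (M * cnot j k) x y = M x (y + Pi.single k (y j)) := by
  simp [Matrix.mul_apply, cnot_apply]

theorem cnot_mul_self (h : j ≠ k) : cnot j k * cnot j k = 1 := by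
  ext x y
  rw [cnot_mul_apply h, cnot_apply, Matrix.one_apply]
  refine if_congr ?_ rfl rfl
  rw [eq_add_single_comm h]
  simp [Pi.single_eq_of_ne h, add_assoc, bits_add_self, @eq_comm _ y x]

theorem cnot_mul_weyl (h : j ≠ k) (a b : Fin n → ZMod 2) :
    cnot j k * weyl a b =
      weyl (a + Pi.single k (a j)) (b + Pi.single j (b k)) * cnot j k := by
  ext x y
  rw [cnot_mul_apply h, mul_cnot_apply]
  simp only [weyl, Matrix.of_apply]
  refine if_congr ?_ ?_ rfl
  · rw [eq_comm, ← eq_add_single_comm h x (y + a), Pi.add_apply, Pi.single_add,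
      add_add_add_comm]
  · congr 1
    simp only [add_dotProduct, dotProduct_add, single_dotProduct, dotProduct_single,
      Pi.add_apply, Pi.single_eq_of_ne h.symm]
    linear_combination -CharTwo.add_self_eq_zero (b k * y j)

end ControlledNot

section CliffordGroup

open scoped Matrix

variable {n : ℕ} {g C D : QMat n}

/-- The generators of the Clifford group, as a predicate on matrices. -/
def IsCliffordGate (g : QMat n) : Prop :=
  (∃ j : Fin n, g = onQubit j hadamard) ∨ (∃ j : Fin n, g = onQubit j phaseS) ∨
    ∃ j k : Fin n, j ≠ k ∧ g = cnot j k

theorem IsCliffordGate.mul_conjTranspose_self (hg : IsCliffordGate g) : g * gᴴ = 1 := by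
  rcases hg with ⟨j, rfl⟩ | ⟨j, rfl⟩ | ⟨j, k, hjk, rfl⟩
  · rw [onQubit_conjTranspose, ← onQubit_mul, hadamard_conjTranspose, hadamard_mul_self,
      onQubit_one]
  · rw [onQubit_conjTranspose, ← onQubit_mul, phaseS_mul_conjTranspose, onQubit_one]
  · rw [cnot_conjTranspose hjk, cnot_mul_self hjk]

theorem IsCliffordGate.pow_four (hg : IsCliffordGate g) : g ^ 4 = 1 := by
  have of_mul_self : ∀ h : QMat n, h * h = 1 → h ^ 4 = 1 := fun h hh => by
    rw [show 4 = 2 * 2 from rfl, pow_mul, pow_two h, hh, one_pow]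
  rcases hg with ⟨j, rfl⟩ | ⟨j, rfl⟩ | ⟨j, k, hjk, rfl⟩
  · exact of_mul_self _ (by rw [← onQubit_mul, hadamard_mul_self, onQubit_one])
  · rw [← onQubit_pow, phaseS_pow_four, onQubit_one]
  · exact of_mul_self _ (cnot_mul_self hjk)

theorem IsCliffordGate.exists_mul_weyl (hg : IsCliffordGate g) (a b : Fin n → ZMod 2) :
    ∃ (c : ℂ) (a' b' : Fin n → ZMod 2), c ^ 4 = 1 ∧ g * weyl a b = c • (weyl a' b' * g) := by
  rcases hg with ⟨j, rfl⟩ | ⟨j, rfl⟩ | ⟨j, k, hjk, rfl⟩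
  · exact ⟨_, _, _, signChar_pow_four _, onQubit_mul_weyl (hadamard_mul_weylOne _ _)⟩
  · exact ⟨_, _, _, by rw [pow_right_comm, Complex.I_pow_four, one_pow],
      onQubit_mul_weyl (phaseS_mul_weylOne _ _)⟩
  · exact ⟨1, _, _, one_pow 4, by rw [cnot_mul_weyl hjk, one_smul]⟩

theorem IsCliffordGate.conjMap_eq (hg : IsCliffordGate g) :
    ∃ b : Fin n → ZMod 2, conjMap n g = weyl 0 b * g := by
  rcases hg with ⟨j, rfl⟩ | ⟨j, rfl⟩ | ⟨j, k, -, rfl⟩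
  · exact ⟨0, by rw [conjMap_onQubit, hadamard_map_conj, weyl_zero, one_mul]⟩
  · exact ⟨Pi.single j 1, by
      rw [conjMap_onQubit, phaseS_map_conj, onQubit_mul, weyl_zero_single]⟩
  · exact ⟨0, by rw [conjMap_cnot, weyl_zero, one_mul]⟩

theorem IsCliffordGate.mem_cliffords (hg : IsCliffordGate g) : g ∈ cliffords n :=
  ⟨⟨g, Matrix.mem_unitaryGroup_iff.2 hg.mul_conjTranspose_self⟩, Subgroup.subset_closure hg, rfl⟩

theorem hadamard_mem_cliffords (j : Fin n) : onQubit j hadamard ∈ cliffords n :=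
  IsCliffordGate.mem_cliffords (.inl ⟨j, rfl⟩)

theorem phaseS_mem_cliffords (j : Fin n) : onQubit j phaseS ∈ cliffords n :=
  IsCliffordGate.mem_cliffords (.inr (.inl ⟨j, rfl⟩))

theorem cnot_mem_cliffords {j k : Fin n} (hjk : j ≠ k) : cnot j k ∈ cliffords n :=
  IsCliffordGate.mem_cliffords (.inr (.inr ⟨j, k, hjk, rfl⟩))

theorem one_mem_cliffords (n : ℕ) : (1 : QMat n) ∈ cliffords n :=
  ⟨1, one_mem _, rfl⟩

theorem mul_mem_cliffords (hC : C ∈ cliffords n) (hD : D ∈ cliffords n) : C * D ∈ cliffords n := by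
  obtain ⟨U, hU, rfl⟩ := hC
  obtain ⟨V, hV, rfl⟩ := hD
  exact ⟨U * V, mul_mem hU hV, rfl⟩

theorem conjTranspose_mem_cliffords (hC : C ∈ cliffords n) : Cᴴ ∈ cliffords n := by
  obtain ⟨U, hU, rfl⟩ := hC
  exact ⟨U⁻¹, inv_mem hU, rfl⟩

theorem cliffords_mul_conjTranspose_self (hC : C ∈ cliffords n) : C * Cᴴ = 1 := by
  obtain ⟨U, -, rfl⟩ := hC
  exact Matrix.mem_unitaryGroup_iff.1 U.2

theorem cliffords_conjTranspose_mul_self (hC : C ∈ cliffords n) : Cᴴ * C = 1 :=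
  mul_eq_one_comm.1 (cliffords_mul_conjTranspose_self hC)

-- No inverses of generators are needed: every generator satisfies `g⁻¹ = g ^ 3`.
theorem cliffords_induction {p : QMat n → Prop} (one : p 1)
    (gate_mul : ∀ g C, IsCliffordGate g → p C → p (g * C)) (hC : C ∈ cliffords n) : p C := by
  obtain ⟨U, hU, rfl⟩ := hC
  induction hU using Subgroup.closure_induction_left with
  | one => exact one
  | mul_left V hV W _ ih => exact gate_mul _ _ hV ih
  | inv_mul_cancel V hV W _ ih =>
    have hV4 : V ^ 4 = 1 := Subtype.ext (IsCliffordGate.pow_four hV)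
    have inv_eq : V⁻¹ = V ^ 3 := inv_eq_of_mul_eq_one_right (by rw [← pow_succ', hV4])
    rw [inv_eq, pow_succ, sq, mul_assoc, mul_assoc]
    exact gate_mul _ _ hV (gate_mul _ _ hV (gate_mul _ _ hV ih))

theorem cliffords_zero : cliffords 0 = {1} := by
  refine Set.eq_singleton_iff_unique_mem.2 ⟨one_mem_cliffords 0, fun C hC => ?_⟩
  refine cliffords_induction (p := (· = 1)) rfl (fun g C hg _ => ?_) hC
  rcases hg with ⟨j, -⟩ | ⟨j, -⟩ | ⟨j, -⟩ <;> exact j.elim0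

theorem cliffords_det_pow_four (hC : C ∈ cliffords n) : C.det ^ 4 = 1 := by
  refine cliffords_induction (p := fun C => C.det ^ 4 = 1) (by simp) (fun g C hg hC => ?_) hC
  rw [Matrix.det_mul, mul_pow, hC, mul_one, ← Matrix.det_pow, hg.pow_four, Matrix.det_one]

theorem smul_mem_cliffords {c : ℂ} (hc : c • (1 : QMat n) ∈ cliffords n) (hC : C ∈ cliffords n) :
    c • C ∈ cliffords n := by
  simpa using mul_mem_cliffords hc hC

theorem omegaEight_smul_mem_cliffords [NeZero n] (hC : C ∈ cliffords n) :
    omegaEight • C ∈ cliffords n := by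
  refine smul_mem_cliffords ?_ hC
  have hHS : onQubit (0 : Fin n) (hadamard * phaseS) ∈ cliffords n := by
    rw [onQubit_mul]
    exact mul_mem_cliffords (hadamard_mem_cliffords 0) (phaseS_mem_cliffords 0)
  rw [← onQubit_one 0, ← onQubit_smul, ← hadamard_mul_phaseS_pow_three, onQubit_pow, pow_succ, sq]
  exact mul_mem_cliffords (mul_mem_cliffords hHS hHS) hHS

theorem I_smul_mem_cliffords [NeZero n] (hC : C ∈ cliffords n) : Complex.I • C ∈ cliffords n := by
  rw [← omegaEight_sq, sq, ← smul_smul]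
  exact omegaEight_smul_mem_cliffords (omegaEight_smul_mem_cliffords hC)

end CliffordGroup

section PauliGroup

open scoped Matrix

variable {n : ℕ} {g C P : QMat n}

/-- The Pauli group: the Weyl operators up to fourth roots of unity. -/
def pauliGroup (n : ℕ) : Submonoid (QMat n) where
  carrier := {P | ∃ (c : ℂ) (a b : Fin n → ZMod 2), c ^ 4 = 1 ∧ P = c • weyl a b}
  one_mem' := ⟨1, 0, 0, one_pow 4, by rw [weyl_zero, one_smul]⟩
  mul_mem' := by
    rintro _ _ ⟨c, a, b, hc, rfl⟩ ⟨d, a', b', hd, rfl⟩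
    refine ⟨c * d * signChar (b ⬝ᵥ a'), a + a', b + b', ?_, ?_⟩
    · rw [mul_pow, mul_pow, hc, hd, signChar_pow_four, one_mul, one_mul]
    · rw [smul_mul_smul_comm, weyl_mul, smul_smul]

theorem weyl_mem_pauliGroup (a b : Fin n → ZMod 2) : weyl a b ∈ pauliGroup n :=
  ⟨1, a, b, one_pow 4, (one_smul ℂ _).symm⟩

theorem pauliZ_mem_pauliGroup (z : Fin n → ZMod 2) : pauliZ z ∈ pauliGroup n :=
  pauliZ_eq_weyl z ▸ weyl_mem_pauliGroup 0 z

theorem smul_mem_pauliGroup {c : ℂ} (hc : c ^ 4 = 1) (hP : P ∈ pauliGroup n) :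
    c • P ∈ pauliGroup n := by
  obtain ⟨d, a, b, hd, rfl⟩ := hP
  exact ⟨c * d, a, b, by rw [mul_pow, hc, hd, one_mul], smul_smul _ _ _⟩

theorem pauliGroup_mul_self_eq (hP : P ∈ pauliGroup n) : P * P = 1 ∨ P * P = -1 := by
  obtain ⟨c, a, b, hc, rfl⟩ := hP
  have hsq : (c * c * signChar (b ⬝ᵥ a)) * (c * c * signChar (b ⬝ᵥ a)) = 1 := by
    linear_combination signChar (b ⬝ᵥ a) * signChar (b ⬝ᵥ a) * hc + signChar_mul_self (b ⬝ᵥ a)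
  rw [smul_mul_smul_comm, weyl_mul_self, smul_smul]
  rcases mul_self_eq_one_iff.1 hsq with h | h
  · exact .inl (by rw [h, one_smul])
  · exact .inr (by rw [h, neg_one_smul])

theorem exists_smul_mul_self_eq_one (hP : P ∈ pauliGroup n) :
    ∃ c : ℂ, c ^ 4 = 1 ∧ (c • P) * (c • P) = 1 := by
  rcases pauliGroup_mul_self_eq hP with h | h
  · exact ⟨1, one_pow 4, by rw [one_smul, h]⟩
  · exact ⟨Complex.I, Complex.I_pow_four, by
      rw [smul_mul_smul_comm, h, Complex.I_mul_I, neg_one_smul, neg_neg]⟩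

theorem IsCliffordGate.conj_mem_pauliGroup (hg : IsCliffordGate g) (hP : P ∈ pauliGroup n) :
    g * P * gᴴ ∈ pauliGroup n := by
  obtain ⟨c, a, b, hc, rfl⟩ := hP
  obtain ⟨d, a', b', hd, h⟩ := hg.exists_mul_weyl a b
  rw [mul_smul_comm, h, smul_mul_assoc, smul_mul_assoc, mul_assoc, hg.mul_conjTranspose_self,
    mul_one]
  exact smul_mem_pauliGroup hc (smul_mem_pauliGroup hd (weyl_mem_pauliGroup a' b'))

theorem cliffords_conj_mem_pauliGroup (hC : C ∈ cliffords n) :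
    ∀ P ∈ pauliGroup n, C * P * Cᴴ ∈ pauliGroup n := by
  refine cliffords_induction (p := fun C => ∀ P ∈ pauliGroup n, C * P * Cᴴ ∈ pauliGroup n)
    (fun P hP => by simpa using hP) (fun g C hg ih P hP => ?_) hC
  rw [Matrix.conjTranspose_mul, show g * C * P * (Cᴴ * gᴴ) = g * (C * P * Cᴴ) * gᴴ by noncomm_ring]
  exact hg.conj_mem_pauliGroup (ih P hP)

theorem conjMap_mul_conjTranspose_mem_pauliGroup (hC : C ∈ cliffords n) :
    conjMap n C * Cᴴ ∈ pauliGroup n := by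
  refine cliffords_induction (p := fun C => conjMap n C * Cᴴ ∈ pauliGroup n)
    (by simp) (fun g C hg ih => ?_) hC
  obtain ⟨b, hb⟩ := hg.conjMap_eq
  rw [conjMap_mul, hb, Matrix.conjTranspose_mul,
    show weyl 0 b * g * conjMap n C * (Cᴴ * gᴴ) = weyl 0 b * (g * (conjMap n C * Cᴴ) * gᴴ) by
      noncomm_ring]
  exact mul_mem (weyl_mem_pauliGroup 0 b) (hg.conj_mem_pauliGroup ih)

end PauliGroup

section InvolutionRoot

variable {A : Type*} [Ring A] [Algebra ℂ A] {p q z : A}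

/-- The square root of an involution `p` that has eigenvalue `1` where `p` has eigenvalue `1`, and
`i` where `p` has eigenvalue `-1`. -/
noncomputable def involutionRoot (p : A) : A :=
  ((1 + Complex.I) / 2) • (1 : A) + ((1 - Complex.I) / 2) • p

theorem involutionRoot_mul_self (hp : p * p = 1) : involutionRoot p * involutionRoot p = p := by
  have hI := Complex.I_sq
  simp only [involutionRoot, add_mul, mul_add, smul_mul_smul_comm, mul_one, one_mul, hp]
  match_scalars <;> grind

theorem involutionRoot_mul (hp : p * p = 1) :
    involutionRoot p * p = ((1 - Complex.I) / 2) • 1 + ((1 + Complex.I) / 2) • p := by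
  simp only [involutionRoot, add_mul, smul_mul_assoc, one_mul, hp]
  exact add_comm _ _

theorem involutionRoot_one : involutionRoot (1 : A) = 1 := by
  rw [involutionRoot, ← add_smul, show (1 + Complex.I) / 2 + (1 - Complex.I) / 2 = 1 by ring,
    one_smul]

theorem involutionRoot_neg (hp : p * p = 1) :
    involutionRoot (-p) = Complex.I • (involutionRoot p * p) := by
  have hI := Complex.I_sq
  rw [involutionRoot_mul hp, involutionRoot]
  match_scalars <;> grind

theorem involutionRoot_conj {u v : A} (huv : u * v = 1) (p : A) :
    involutionRoot (u * p * v) = u * involutionRoot p * v := by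
  simp only [involutionRoot, mul_add, add_mul, mul_smul_comm, smul_mul_assoc, mul_one, huv]

theorem involutionRoot_I_smul (p : A) :
    involutionRoot (Complex.I • p) = ((1 + Complex.I) / 2) • (1 + p) := by
  have hI := Complex.I_sq
  rw [involutionRoot]
  match_scalars <;> grind

theorem involutionRoot_mem (B : Subalgebra ℂ A) (hp : p ∈ B) : involutionRoot p ∈ B :=
  add_mem (B.smul_mem (one_mem B) _) (B.smul_mem hp _)

/-- For commuting involutions `p` and `q`, the operator that acts as `1` where `p = 1` and as `q`
where `p = -1`. -/
noncomputable def controlled (p q : A) : A :=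
  (1 / 2 : ℂ) • (1 + p + q - p * q)

theorem controlled_eq_involutionRoot_mul (hp : p * p = 1) (hq : q * q = 1) (hpq : p * q = q * p) :
    controlled p q =
      involutionRoot p * involutionRoot q * (involutionRoot (p * q) * (p * q)) := by
  have hI := Complex.I_sq
  have hpq_sq : p * q * (p * q) = 1 := by
    rw [mul_assoc, ← mul_assoc q, ← hpq, mul_assoc p q q, hq, mul_one, hp]
  have h1 : p * (p * q) = q := by rw [← mul_assoc, hp, one_mul]
  have h2 : q * (p * q) = p := by rw [hpq, ← mul_assoc, hq, one_mul]
  rw [involutionRoot_mul hpq_sq]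
  simp only [involutionRoot, controlled, add_mul, mul_add, smul_mul_smul_comm, mul_one, one_mul,
    mul_assoc, h1, h2, hp]
  match_scalars <;> grind

theorem one_add_mul_controlled (hp : p * p = 1) (q : A) : (1 + p) * controlled p q = 1 + p := by
  simp only [controlled, mul_smul_comm, add_mul, one_mul, mul_sub, mul_add, mul_one, ← mul_assoc,
    hp]
  module

theorem mul_controlled_mul (hp : p * p = 1) (hpq : p * q = q * p) (hzp : z * p = p * z)
    (hzq : z * q = -(q * z)) : z * controlled p q * p = controlled p q * z := by
  have h1 : z * q * p = -(p * q * z) := by rw [hzq, neg_mul, mul_assoc, hzp, ← mul_assoc, ← hpq]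
  have h2 : z * (p * q) * p = -(q * z) := by
    rw [mul_assoc, mul_assoc, ← hpq, ← mul_assoc p, hp, one_mul, hzq]
  have h3 : p * z * p = z := by rw [← hzp, mul_assoc, hp, mul_one]
  simp only [controlled, mul_smul_comm, smul_mul_assoc, mul_sub, mul_add, sub_mul, add_mul, one_mul,
    mul_one, h1, h2, h3, hzp]
  module

theorem controlled_mem (B : Subalgebra ℂ A) (hp : p ∈ B) (hq : q ∈ B) : controlled p q ∈ B :=
  B.smul_mem (sub_mem (add_mem (add_mem (one_mem B) hp) hq) (mul_mem hp hq)) _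

end InvolutionRoot

section PauliRoots

open scoped Matrix

variable {n : ℕ} {a b : Fin n → ZMod 2} {P Q : QMat n}

/-- The square roots of both involutions proportional to `X^a Z^b` are Clifford unitaries. -/
def HasCliffordRoot (a b : Fin n → ZMod 2) : Prop :=
  ∀ c : ℂ, (c • weyl a b) * (c • weyl a b) = 1 → involutionRoot (c • weyl a b) ∈ cliffords n

theorem hasCliffordRoot_of_involutionRoot_mem [NeZero n] (h : weyl a b * weyl a b = 1)
    (hab : involutionRoot (weyl a b) ∈ cliffords n) : HasCliffordRoot a b := by
  intro c hc
  have hc1 : c * c = 1 := by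
    rw [smul_mul_smul_comm, h] at hc
    simpa using congrFun (congrFun hc 0) 0
  rcases mul_self_eq_one_iff.1 hc1 with rfl | rfl
  · rwa [one_smul]
  · rw [neg_one_smul, involutionRoot_neg h]
    nth_rw 2 [← involutionRoot_mul_self h]
    exact I_smul_mem_cliffords (mul_mem_cliffords hab (mul_mem_cliffords hab hab))

theorem HasCliffordRoot.of_conj {g : QMat n} (hg : g ∈ cliffords n) {a' b' : Fin n → ZMod 2}
    {d : ℂ} (h : g * weyl a b = d • (weyl a' b' * g)) (H : HasCliffordRoot a' b') :
    HasCliffordRoot a b := by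
  intro c hc
  have hg' := cliffords_conjTranspose_mul_self hg
  have hQ : (c * d) • weyl a' b' = g * (c • weyl a b) * gᴴ := by
    rw [mul_smul_comm, h, smul_mul_assoc, smul_mul_assoc, mul_assoc,
      cliffords_mul_conjTranspose_self hg, mul_one, smul_smul]
  have hP : c • weyl a b = gᴴ * ((c * d) • weyl a' b') * g := by
    rw [hQ, mul_assoc, mul_assoc _ gᴴ, hg', mul_one, ← mul_assoc, hg', one_mul]
  have hsq : ((c * d) • weyl a' b') * ((c * d) • weyl a' b') = 1 := by
    calc _ = g * (c • weyl a b) * (gᴴ * g) * (c • weyl a b) * gᴴ := by rw [hQ]; noncomm_ring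
      _ = 1 := by
        rw [hg', mul_one, mul_assoc g, hc, mul_one, cliffords_mul_conjTranspose_self hg]
  rw [hP, involutionRoot_conj hg']
  exact mul_mem_cliffords (mul_mem_cliffords (conjTranspose_mem_cliffords hg) (H _ hsq)) hg

theorem hasCliffordRoot_zero [NeZero n] : HasCliffordRoot (0 : Fin n → ZMod 2) 0 :=
  hasCliffordRoot_of_involutionRoot_mem (by simp)
    (by rw [weyl_zero, involutionRoot_one]; exact one_mem_cliffords n)

theorem involutionRoot_weyl_zero_single (j : Fin n) :
    involutionRoot (weyl 0 (Pi.single j 1)) = onQubit j phaseS := by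
  have phaseS_eq : phaseS = involutionRoot (weylOne 0 1) := by
    apply matrix_zmod_two_ext <;> simp [phaseS, involutionRoot, weylOne, ZMod.val_one] <;> ring
  rw [phaseS_eq, involutionRoot, involutionRoot, onQubit_add, onQubit_smul, onQubit_smul,
    onQubit_one, weyl_zero_single]

theorem hasCliffordRoot_zero_single [NeZero n] (j : Fin n) :
    HasCliffordRoot (0 : Fin n → ZMod 2) (Pi.single j 1) :=
  hasCliffordRoot_of_involutionRoot_mem (by simp [weyl_mul_self])
    (by rw [involutionRoot_weyl_zero_single]; exact phaseS_mem_cliffords j)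

theorem HasCliffordRoot.update_of_apply_eq_one {j k : Fin n} (hjk : j ≠ k) (hk : b k = 1)
    (H : HasCliffordRoot 0 b) (t : ZMod 2) : HasCliffordRoot 0 (Function.update b j t) := by
  obtain rfl | rfl : t = b j ∨ t = b j + 1 := by
    rcases zmod_two_eq_zero_or_one (t - b j) with h | h
    · exact .inl (sub_eq_zero.1 h)
    · exact .inr (sub_eq_iff_eq_add'.1 h)
  · rwa [Function.update_eq_self]
  · refine .of_conj (cnot_mem_cliffords hjk) ((cnot_mul_weyl hjk _ _).trans (one_smul ℂ _).symm) ?_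
    convert H using 1
    · simp
    · funext l
      rcases eq_or_ne l j with rfl | hl
      · simp [hjk.symm, hk, add_assoc, CharTwo.add_self_eq_zero]
      · simp [hl]

theorem hasCliffordRoot_zero_left [NeZero n] (b : Fin n → ZMod 2) : HasCliffordRoot 0 b := by
  obtain rfl | hb := eq_or_ne b 0
  · exact hasCliffordRoot_zero
  obtain ⟨k, hk⟩ := Function.ne_iff.1 hb
  replace hk : b k = 1 := (zmod_two_eq_zero_or_one _).resolve_left hk
  suffices H : ∀ s : Finset (Fin n), s.piecewise b (Pi.single k 1) k = 1 ∧
      HasCliffordRoot 0 (s.piecewise b (Pi.single k 1)) by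
    simpa using (H Finset.univ).2
  intro s
  induction s using Finset.induction_on with
  | empty => simpa using hasCliffordRoot_zero_single k
  | insert j s _ ih =>
    rw [Finset.piecewise_insert]
    rcases eq_or_ne j k with rfl | hjk
    · have hupd : Function.update (s.piecewise b (Pi.single j 1)) j (b j) = _ :=
        Function.update_eq_self_iff.2 (hk.trans ih.1.symm)
      rwa [hupd]
    · exact ⟨by rw [Function.update_of_ne hjk.symm, ih.1], ih.2.update_of_apply_eq_one hjk ih.1 _⟩

-- A phase gate removes a factor `Z` on qubit `j`, and a Hadamard gate then turns `X` into `Z`.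
theorem hasCliffordRoot_update_left {j : Fin n} (hj : a j = 0)
    (H : ∀ b, HasCliffordRoot a b) (t : ZMod 2) (b : Fin n → ZMod 2) :
    HasCliffordRoot (Function.update a j t) b := by
  rcases zmod_two_eq_zero_or_one t with rfl | rfl
  · rw [← hj, Function.update_eq_self]
    exact H b
  have of_eq_zero : ∀ b : Fin n → ZMod 2, b j = 0 →
      HasCliffordRoot (Function.update a j 1) b := fun b hb => by
    refine .of_conj (hadamard_mem_cliffords j) (onQubit_mul_weyl (hadamard_mul_weylOne _ _)) ?_
    rw [Function.update_idem, hb, ← hj, Function.update_eq_self]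
    exact H _
  rcases zmod_two_eq_zero_or_one (b j) with hb | hb
  · exact of_eq_zero b hb
  · refine .of_conj (phaseS_mem_cliffords j) (onQubit_mul_weyl (phaseS_mul_weylOne _ _)) ?_
    rw [Function.update_eq_self]
    exact of_eq_zero _ (by simp [hb, CharTwo.add_self_eq_zero])

theorem hasCliffordRoot [NeZero n] (a b : Fin n → ZMod 2) : HasCliffordRoot a b := by
  suffices H : ∀ s : Finset (Fin n), ∀ b, HasCliffordRoot (s.piecewise a 0) b by
    simpa using H Finset.univ b
  intro s
  induction s using Finset.induction_on with
  | empty => simpa using hasCliffordRoot_zero_left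
  | insert j s hj ih =>
    rw [Finset.piecewise_insert]
    exact hasCliffordRoot_update_left (by simp [hj]) ih _

theorem involutionRoot_mem_cliffords [NeZero n] (hP : P ∈ pauliGroup n) (h : P * P = 1) :
    involutionRoot P ∈ cliffords n := by
  obtain ⟨c, a, b, -, rfl⟩ := hP
  exact hasCliffordRoot a b c h

theorem pauli_involution_mem_cliffords [NeZero n] (hP : P ∈ pauliGroup n) (h : P * P = 1) :
    P ∈ cliffords n := by
  have hroot := involutionRoot_mem_cliffords hP h
  rw [← involutionRoot_mul_self h]
  exact mul_mem_cliffords hroot hroot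

theorem controlled_mem_cliffords [NeZero n] (hP : P ∈ pauliGroup n) (hQ : Q ∈ pauliGroup n)
    (hPP : P * P = 1) (hQQ : Q * Q = 1) (hPQ : P * Q = Q * P) : controlled P Q ∈ cliffords n := by
  have hsq : P * Q * (P * Q) = 1 := by
    rw [mul_assoc, ← mul_assoc Q, ← hPQ, mul_assoc P Q Q, hQQ, mul_one, hPP]
  have hmul := mul_mem hP hQ
  rw [controlled_eq_involutionRoot_mul hPP hQQ hPQ]
  exact mul_mem_cliffords
    (mul_mem_cliffords (involutionRoot_mem_cliffords hP hPP) (involutionRoot_mem_cliffords hQ hQQ))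
    (mul_mem_cliffords (involutionRoot_mem_cliffords hmul hsq)
      (pauli_involution_mem_cliffords hmul hsq))

end PauliRoots

section DecompositionBall

variable {n : ℕ} {S T : Set (QMat n)} {r s : ℝ} {M N : QMat n}

/-- The matrices that have a decomposition over `S` with coefficients of `ℓ₁`-norm at most `r`. -/
def decompositionBall (S : Set (QMat n)) (r : ℝ) : Set (QMat n) :=
  {M | ∃ x : S →₀ ℂ, IsDecomposition x M ∧ (x.sum fun _ c => ‖c‖) ≤ r}

theorem zero_mem_decompositionBall : (0 : QMat n) ∈ decompositionBall S 0 :=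
  ⟨0, by simp [IsDecomposition], by simp⟩

theorem decompositionBall_subset_of_le (hrs : r ≤ s) :
    decompositionBall S r ⊆ decompositionBall S s :=
  fun _ ⟨x, hx, hr⟩ => ⟨x, hx, hr.trans hrs⟩

theorem smul_mem_decompositionBall {C : QMat n} (hC : C ∈ S) (c : ℂ) :
    c • C ∈ decompositionBall S ‖c‖ :=
  ⟨Finsupp.single ⟨C, hC⟩ c, by simp [IsDecomposition], by simp⟩

theorem add_mem_decompositionBall (hM : M ∈ decompositionBall S r)
    (hN : N ∈ decompositionBall S s) : M + N ∈ decompositionBall S (r + s) := by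
  classical
  obtain ⟨x, hx, hr⟩ := hM
  obtain ⟨y, hy, hs⟩ := hN
  refine ⟨x + y, ?_, le_trans ?_ (add_le_add hr hs)⟩
  · rw [IsDecomposition] at *
    rw [Finsupp.sum_add_index' (by simp) (by intros; rw [add_smul]), ← hx, ← hy]
  · rw [Finsupp.sum_of_support_subset x Finset.subset_union_left _ (by simp),
      Finsupp.sum_of_support_subset y Finset.subset_union_right _ (by simp),
      Finsupp.sum_of_support_subset (x + y) Finsupp.support_add _ (by simp),
      ← Finset.sum_add_distrib]
    exact Finset.sum_le_sum fun i _ => norm_add_le _ _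

theorem sum_mem_decompositionBall {ι : Type*} (t : Finset ι) {r : ι → ℝ} {M : ι → QMat n}
    (h : ∀ i ∈ t, M i ∈ decompositionBall S (r i)) :
    ∑ i ∈ t, M i ∈ decompositionBall S (∑ i ∈ t, r i) := by
  classical
  induction t using Finset.induction_on with
  | empty => exact zero_mem_decompositionBall
  | insert a t ha ih =>
    rw [Finset.sum_insert ha, Finset.sum_insert ha]
    exact add_mem_decompositionBall (h a (Finset.mem_insert_self a t))
      (ih fun i hi => h i (Finset.mem_insert_of_mem hi))

theorem map_mem_decompositionBall (Φ : QMat n →+ QMat n)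
    (h : ∀ C ∈ S, ∀ c : ℂ, Φ (c • C) ∈ decompositionBall T ‖c‖) (hM : M ∈ decompositionBall S r) :
    Φ M ∈ decompositionBall T r := by
  obtain ⟨x, rfl, hr⟩ := hM
  rw [Finsupp.sum, map_sum]
  exact decompositionBall_subset_of_le hr
    (sum_mem_decompositionBall x.support fun C _ => h C C.2 (x C))

theorem decompositionBall_subset_of_subset (hST : S ⊆ T) (r : ℝ) :
    decompositionBall S r ⊆ decompositionBall T r := fun _ hM =>
  map_mem_decompositionBall (AddMonoidHom.id _)
    (fun _ hC c => smul_mem_decompositionBall (hST hC) c) hM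

/-- The average `M ↦ (M + φ M) / 2` of the identity and `φ`. -/
noncomputable def symmAverage (φ : QMat n ≃ₗ[ℝ] QMat n) : QMat n →+ QMat n where
  toFun M := (1 / 2 : ℂ) • (M + φ M)
  map_zero' := by simp
  map_add' M N := by rw [map_add, ← smul_add, add_add_add_comm]

theorem symmAverage_apply (φ : QMat n ≃ₗ[ℝ] QMat n) (M : QMat n) :
    symmAverage φ M = (1 / 2 : ℂ) • (M + φ M) := rfl

theorem symmAverage_of_apply_eq {φ : QMat n ≃ₗ[ℝ] QMat n} (hφ : φ M = M) :
    symmAverage φ M = M := by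
  rw [symmAverage_apply, hφ]
  module

theorem mem_decompositionBall_of_apply_eq {φ : QMat n ≃ₗ[ℝ] QMat n} (hφ : φ M = M)
    (h : ∀ C ∈ S, ∀ c : ℂ, symmAverage φ (c • C) ∈ decompositionBall T ‖c‖)
    (hM : M ∈ decompositionBall S r) : M ∈ decompositionBall T r := by
  rw [← symmAverage_of_apply_eq hφ]
  exact map_mem_decompositionBall (symmAverage φ) h hM

end DecompositionBall

section OptimalDecomposition

variable {n : ℕ} {S T : Set (QMat n)} {M : QMat n}

theorem exists_isDecomposition_forall_le (hS : S.Finite)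
    (hM : ∃ x : S →₀ ℂ, IsDecomposition x M) :
    ∃ x : S →₀ ℂ, IsDecomposition x M ∧ ∀ y : S →₀ ℂ, IsDecomposition y M →
      (x.sum fun _ c => ‖c‖) ≤ y.sum fun _ c => ‖c‖ := by
  have := hS.fintype
  let F : Set (PiLp 1 fun _ : S => ℂ) := {v | M = ∑ C : S, v C • (C : QMat n)}
  have hF : IsClosed F := isClosed_eq continuous_const (by fun_prop)
  have mem_F (x : S →₀ ℂ) : IsDecomposition x M ↔ WithLp.toLp 1 (x : S → ℂ) ∈ F := by
    rw [IsDecomposition, Finsupp.sum_fintype _ _ (by simp)]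
    rfl
  have sum_eq_norm (x : S →₀ ℂ) :
      (x.sum fun _ c => ‖c‖) = ‖(WithLp.toLp 1 (x : S → ℂ) : PiLp 1 fun _ : S => ℂ)‖ := by
    rw [Finsupp.sum_fintype _ _ (by simp), PiLp.norm_eq_of_L1]
  obtain ⟨x₀, hx₀⟩ := hM
  obtain ⟨v, hv, hmin⟩ := hF.exists_infDist_eq_dist ⟨_, (mem_F x₀).1 hx₀⟩ 0
  obtain ⟨x, rfl⟩ : ∃ x : S →₀ ℂ, WithLp.toLp 1 (x : S → ℂ) = v :=
    ⟨Finsupp.equivFunOnFinite.symm (WithLp.ofLp v), by simp⟩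
  refine ⟨x, (mem_F x).2 hv, fun y hy => ?_⟩
  rw [sum_eq_norm, sum_eq_norm, ← dist_zero_left, ← dist_zero_left, ← hmin]
  exact Metric.infDist_le_dist_of_mem ((mem_F y).1 hy)

theorem isLeast_costSet_decompositionCost {x : S →₀ ℂ} (hx : IsDecomposition x M)
    (hmin : ∀ y : S →₀ ℂ, IsDecomposition y M →
      (x.sum fun _ c => ‖c‖) ≤ y.sum fun _ c => ‖c‖) :
    IsLeast (costSet S M) (decompositionCost x) := by
  refine ⟨⟨x, hx, rfl⟩, ?_⟩
  rintro _ ⟨y, hy, rfl⟩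
  exact pow_le_pow_left₀ (Finset.sum_nonneg fun _ _ => norm_nonneg _) (hmin y hy) 2

theorem exists_isDecomposition_of_subset (hTS : T ⊆ S) {y : T →₀ ℂ} (hy : IsDecomposition y M) :
    ∃ x : S →₀ ℂ, IsDecomposition x M ∧ decompositionCost x = decompositionCost y ∧
      ∀ C ∈ x.support, (C : QMat n) ∈ T := by
  refine ⟨y.embDomain (Set.embeddingOfSubset T S hTS), ?_, ?_, fun C hC => ?_⟩
  · rwa [IsDecomposition, Finsupp.sum_embDomain]
  · rw [decompositionCost, Finsupp.sum_embDomain]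
    rfl
  · obtain ⟨D, -, rfl⟩ := Finset.mem_map.1 (Finsupp.support_embDomain _ y ▸ hC)
    exact D.2

theorem costSet_mono (hTS : T ⊆ S) (M : QMat n) : costSet T M ⊆ costSet S M := by
  rintro _ ⟨y, hy, rfl⟩
  obtain ⟨x, hx, hxy, -⟩ := exists_isDecomposition_of_subset hTS hy
  exact ⟨x, hx, hxy⟩

theorem exists_isLeast_costSet_of_decompositionBall (hS : S.Finite) (hTS : T ⊆ S)
    (hM : ∃ x : S →₀ ℂ, IsDecomposition x M)
    (h : ∀ r, M ∈ decompositionBall S r → M ∈ decompositionBall T r) :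
    ∃ m, IsLeast (costSet S M) m ∧ IsLeast (costSet T M) m ∧
      ∃ x : S →₀ ℂ, IsDecomposition x M ∧ decompositionCost x = m ∧
        ∀ C ∈ x.support, (C : QMat n) ∈ T := by
  obtain ⟨x, hx, hmin⟩ := exists_isDecomposition_forall_le hS hM
  obtain ⟨y, hy, hyx⟩ := h _ ⟨x, hx, le_rfl⟩
  have leastS := isLeast_costSet_decompositionCost hx hmin
  have cost_le : decompositionCost y ≤ decompositionCost x :=
    pow_le_pow_left₀ (Finset.sum_nonneg fun _ _ => norm_nonneg _) hyx 2
  have cost_eq : decompositionCost y = decompositionCost x :=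
    cost_le.antisymm (leastS.2 (costSet_mono hTS M ⟨y, hy, rfl⟩))
  refine ⟨_, leastS, ⟨⟨y, hy, cost_eq⟩, fun r hr => leastS.2 (costSet_mono hTS M hr)⟩, ?_⟩
  rw [← cost_eq]
  exact exists_isDecomposition_of_subset hTS hy

end OptimalDecomposition

section SymplecticDuality

variable {n : ℕ} {C P : QMat n}

theorem exists_weyl_anticommute {W : Submodule (ZMod 2) ((Fin n → ZMod 2) × (Fin n → ZMod 2))}
    {v : (Fin n → ZMod 2) × (Fin n → ZMod 2)} (hv : v ∉ W) :
    ∃ a b, weyl v.1 v.2 * weyl a b = -(weyl a b * weyl v.1 v.2) ∧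
      ∀ w ∈ W, weyl w.1 w.2 * weyl a b = weyl a b * weyl w.1 w.2 := by
  obtain ⟨f, hfv, hfW⟩ := Submodule.exists_le_ker_of_notMem hv
  obtain ⟨b, hb⟩ := (dotProductEquiv (ZMod 2) (Fin n)).surjective (f ∘ₗ LinearMap.inl _ _ _)
  obtain ⟨a, ha⟩ := (dotProductEquiv (ZMod 2) (Fin n)).surjective (f ∘ₗ LinearMap.inr _ _ _)
  have f_apply (w : (Fin n → ZMod 2) × (Fin n → ZMod 2)) : w.2 ⬝ᵥ a + w.1 ⬝ᵥ b = f w := by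
    rw [dotProduct_comm w.2, dotProduct_comm w.1]
    calc a ⬝ᵥ w.2 + b ⬝ᵥ w.1 = f (0, w.2) + f (w.1, 0) :=
          congrArg₂ (· + ·) (LinearMap.congr_fun ha w.2) (LinearMap.congr_fun hb w.1)
      _ = f w := by rw [← map_add, Prod.mk_add_mk, add_zero, zero_add]
  refine ⟨a, b, ?_, fun w hw => ?_⟩
  · rw [weyl_mul_comm, f_apply, (zmod_two_eq_zero_or_one _).resolve_left hfv, signChar_one,
      neg_one_smul]
  · rw [weyl_mul_comm, f_apply, LinearMap.mem_ker.1 (hfW hw), AddChar.map_zero_eq_one, one_smul]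

/-- The labels of the Weyl operators that commute with `C`. -/
def weylCommutant (C : QMat n) : Submodule (ZMod 2) ((Fin n → ZMod 2) × (Fin n → ZMod 2)) where
  carrier := {v | weyl v.1 v.2 * C = C * weyl v.1 v.2}
  zero_mem' := by simp
  add_mem' := by
    intro v w hv hw
    have hsign : signChar (v.2 ⬝ᵥ w.1) ≠ 0 := left_ne_zero_of_mul_eq_one (signChar_mul_self _)
    refine smul_right_injective _ hsign ?_
    simp only [Set.mem_ofPred_eq, Prod.fst_add, Prod.snd_add] at hv hw ⊢
    rw [← smul_mul_assoc, ← mul_smul_comm, ← weyl_mul, mul_assoc, hw, ← mul_assoc, hv, mul_assoc]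
  smul_mem' := by
    intro t v hv
    rcases zmod_two_eq_zero_or_one t with rfl | rfl
    · simp
    · rwa [one_smul]

theorem mem_weylCommutant {v : (Fin n → ZMod 2) × (Fin n → ZMod 2)} :
    v ∈ weylCommutant C ↔ weyl v.1 v.2 * C = C * weyl v.1 v.2 :=
  Iff.rfl

-- If `v` were `p` plus the label of a Weyl operator commuting with `C`, then conjugation by
-- `weyl v.1 v.2` would map `C` both to `P * C` and to `P * C * P`.
theorem notMem_span_sup_weylCommutant {v p : (Fin n → ZMod 2) × (Fin n → ZMod 2)} {c : ℂ}
    (hC : C ∈ cliffords n) (hP : P = c • weyl p.1 p.2) (hPP : P * P = 1) (hne : P ≠ 1)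
    (hvC : weyl v.1 v.2 * C = P * C * weyl v.1 v.2) :
    v ∉ Submodule.span (ZMod 2) {p} ⊔ weylCommutant C := by
  intro hv
  obtain ⟨_, hp, k, hk, rfl⟩ := Submodule.mem_sup.1 hv
  obtain ⟨t, rfl⟩ := Submodule.mem_span_singleton.1 hp
  have isUnit_C : IsUnit C := .of_mul_eq_one _ (cliffords_mul_conjTranspose_self hC)
  have isUnit_weyl : IsUnit (weyl k.1 k.2) := by
    refine .of_mul_eq_one (signChar (k.2 ⬝ᵥ k.1) • weyl k.1 k.2) ?_
    rw [mul_smul_comm, weyl_mul_self, smul_smul, signChar_mul_self, one_smul]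
  rw [mem_weylCommutant] at hk
  rcases zmod_two_eq_zero_or_one t with rfl | rfl
  · simp only [zero_smul, zero_add] at hvC
    exact hne ((isUnit_C.mul isUnit_weyl).mul_eq_right.1 (by rw [← mul_assoc, ← hvC, hk]))
  · have hPk : P * weyl k.1 k.2 =
        (c * signChar (p.2 ⬝ᵥ k.1)) • weyl ((1 : ZMod 2) • p + k).1 ((1 : ZMod 2) • p + k).2 := by
      rw [hP, smul_mul_assoc, weyl_mul, smul_smul, one_smul, Prod.fst_add, Prod.snd_add]
    have hPkC : P * weyl k.1 k.2 * C = P * C * (P * weyl k.1 k.2) := by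
      rw [hPk, smul_mul_assoc, hvC, mul_smul_comm]
    refine hne (isUnit_weyl.mul_eq_right.1 (isUnit_C.mul_left_cancel ?_))
    calc C * (P * weyl k.1 k.2) = P * P * C * (P * weyl k.1 k.2) := by rw [hPP, one_mul]
      _ = P * P * weyl k.1 k.2 * C := by rw [mul_assoc P P C, mul_assoc P, ← hPkC]; noncomm_ring
      _ = C * weyl k.1 k.2 := by rw [hPP, one_mul, hk]

theorem exists_pauli_anticommute {a b : Fin n → ZMod 2} (hC : C ∈ cliffords n)
    (hP : P ∈ pauliGroup n) (hPP : P * P = 1) (hne : P ≠ 1)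
    (hPC : weyl a b * C = P * C * weyl a b) :
    ∃ A ∈ pauliGroup n, A * A = 1 ∧ weyl a b * A = -(A * weyl a b) ∧ P * A = A * P ∧
      ∀ w, pauliZ w * C = C * pauliZ w → pauliZ w * A = A * pauliZ w := by
  obtain ⟨c, a₁, b₁, -, rfl⟩ := hP
  obtain ⟨a₂, b₂, hv, hW⟩ := exists_weyl_anticommute
    (notMem_span_sup_weylCommutant (v := (a, b)) (p := (a₁, b₁)) hC rfl hPP hne hPC)
  obtain ⟨d, hd, hdd⟩ := exists_smul_mul_self_eq_one (weyl_mem_pauliGroup a₂ b₂)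
  refine ⟨_, smul_mem_pauliGroup hd (weyl_mem_pauliGroup a₂ b₂), hdd, ?_, ?_, fun w hw => ?_⟩
  · rw [mul_smul_comm, hv, smul_neg, smul_mul_assoc]
  · have hp := hW (a₁, b₁) (Submodule.mem_sup_left (Submodule.mem_span_singleton_self _))
    rw [smul_mul_smul_comm, smul_mul_smul_comm, hp, mul_comm]
  · rw [pauliZ_eq_weyl] at hw ⊢
    rw [mul_smul_comm, smul_mul_assoc, hW (0, w) (Submodule.mem_sup_right hw)]

end SymplecticDuality

section UnitarySymmetrization

open scoped Matrix

variable {n : ℕ} {s : Set (Fin n → ZMod 2)} {z : Fin n → ZMod 2} {C P : QMat n}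

/-- The Clifford unitaries that commute with `Z(w)` for all `w ∈ s`. -/
def zInvariantCliffords (s : Set (Fin n → ZMod 2)) : Set (QMat n) :=
  {C | C ∈ cliffords n ∧ C ∈ Subalgebra.centralizer ℂ (pauliZ '' s)}

theorem mem_centralizer_pauliZ :
    C ∈ Subalgebra.centralizer ℂ (pauliZ '' s) ↔ ∀ w ∈ s, pauliZ w * C = C * pauliZ w := by
  rw [Subalgebra.mem_centralizer_iff, Set.forall_mem_image]

theorem pauliZ_mul_comm (z w : Fin n → ZMod 2) : pauliZ z * pauliZ w = pauliZ w * pauliZ z := by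
  rw [← pauliZ_add, ← pauliZ_add, add_comm]

theorem conjTranspose_mem_centralizer_pauliZ
    (hC : C ∈ Subalgebra.centralizer ℂ (pauliZ '' s)) :
    Cᴴ ∈ Subalgebra.centralizer ℂ (pauliZ '' s) := by
  rw [mem_centralizer_pauliZ] at hC ⊢
  intro w hw
  simpa only [Matrix.conjTranspose_mul, pauliZ_conjTranspose]
    using congrArg Matrix.conjTranspose (hC w hw).symm

theorem mem_zInvariantCliffords_insert (hC : C ∈ zInvariantCliffords s)
    (hz : pauliZ z * C = C * pauliZ z) : C ∈ zInvariantCliffords (insert z s) := by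
  refine ⟨hC.1, mem_centralizer_pauliZ.2 ?_⟩
  rintro w (rfl | hw)
  exacts [hz, mem_centralizer_pauliZ.1 hC.2 w hw]

theorem pauliZChannel_apply (z : Fin n → ZMod 2) (M : QMat n) :
    pauliZChannel z M = pauliZ z * M * pauliZ z := by
  change pauliZ z * M * (pauliZ z)ᴴ = _
  rw [pauliZ_conjTranspose]

theorem pauliZChannel_apply_eq_self_iff {M : QMat n} :
    pauliZChannel z M = M ↔ pauliZ z * M = M * pauliZ z := by
  rw [pauliZChannel_apply]
  constructor <;> intro h
  · nth_rw 2 [← h]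
    rw [mul_assoc _ (pauliZ z), pauliZ_mul_self, mul_one]
  · rw [h, mul_assoc, pauliZ_mul_self, mul_one]

theorem symmAverage_pauliZChannel_smul (hPC : pauliZ z * C = P * C * pauliZ z) (c : ℂ) :
    symmAverage (pauliZChannel z) (c • C) = (c / 2) • ((1 + P) * C) := by
  rw [symmAverage_apply, pauliZChannel_apply, mul_smul_comm, smul_mul_assoc, hPC,
    mul_assoc _ (pauliZ z), pauliZ_mul_self, mul_one, add_mul, one_mul]
  module

theorem symmAverage_pauliZChannel_mem_of_mul_self_eq_neg_one [NeZero n]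
    (hC : C ∈ zInvariantCliffords s) (hP : P ∈ pauliGroup n)
    (hPs : P ∈ Subalgebra.centralizer ℂ (pauliZ '' s)) (hPC : pauliZ z * C = P * C * pauliZ z)
    (hPz : pauliZ z * P = -(P * pauliZ z)) (hPP : P * P = -1) (c : ℂ) :
    symmAverage (pauliZChannel z) (c • C) ∈
      decompositionBall (zInvariantCliffords (insert z s)) ‖c‖ := by
  have hIP : (Complex.I • P) * (Complex.I • P) = 1 := by
    rw [smul_mul_smul_comm, hPP, Complex.I_mul_I, neg_one_smul, neg_neg]
  have hroot : involutionRoot (Complex.I • P) * C ∈ zInvariantCliffords s :=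
    ⟨mul_mem_cliffords (involutionRoot_mem_cliffords
      (smul_mem_pauliGroup Complex.I_pow_four hP) hIP) hC.1,
      mul_mem (involutionRoot_mem _ (Subalgebra.smul_mem _ hPs _)) hC.2⟩
  have hcomm : pauliZ z * ((1 + P) * C) = (1 + P) * C * pauliZ z := by
    calc pauliZ z * ((1 + P) * C) = (pauliZ z + pauliZ z * P) * C := by noncomm_ring
      _ = (1 - P) * (pauliZ z * C) := by rw [hPz]; noncomm_ring
      _ = (P - P * P) * C * pauliZ z := by rw [hPC]; noncomm_ring
      _ = (1 + P) * C * pauliZ z := by rw [hPP]; noncomm_ring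
  have hmem := mem_zInvariantCliffords_insert (z := z) hroot (by
    rw [involutionRoot_I_smul, smul_mul_assoc, mul_smul_comm, hcomm, smul_mul_assoc])
  have hsum : symmAverage (pauliZChannel z) (c • C) =
      (c * ((1 - Complex.I) / 2)) • (involutionRoot (Complex.I • P) * C) := by
    rw [symmAverage_pauliZChannel_smul hPC, involutionRoot_I_smul, smul_mul_assoc, smul_smul]
    congr 1
    linear_combination (c / 4) * Complex.I_sq
  have hnorm : ‖(1 - Complex.I) / 2‖ ≤ 1 := by
    rw [norm_div, Complex.norm_two, div_le_one two_pos]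
    refine (norm_sub_le _ _).trans ?_
    rw [norm_one, Complex.norm_I, one_add_one_eq_two]
  rw [hsum]
  refine decompositionBall_subset_of_le ?_ (smul_mem_decompositionBall hmem _)
  rw [norm_mul]
  exact mul_le_of_le_one_right (norm_nonneg c) hnorm

theorem symmAverage_pauliZChannel_mem_of_mul_self_eq_one [NeZero n]
    (hC : C ∈ zInvariantCliffords s) (hP : P ∈ pauliGroup n)
    (hPs : P ∈ Subalgebra.centralizer ℂ (pauliZ '' s)) (hPC : pauliZ z * C = P * C * pauliZ z)
    (hPz : pauliZ z * P = P * pauliZ z) (hPP : P * P = 1) (c : ℂ) :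
    symmAverage (pauliZChannel z) (c • C) ∈
      decompositionBall (zInvariantCliffords (insert z s)) ‖c‖ := by
  have hsum := symmAverage_pauliZChannel_smul hPC c
  obtain rfl | hne := eq_or_ne P 1
  · rw [hsum, ← two_smul ℂ, smul_mul_assoc, one_mul, smul_smul, div_mul_cancel₀ _ two_ne_zero]
    exact smul_mem_decompositionBall (mem_zInvariantCliffords_insert hC (by simpa using hPC)) c
  rw [pauliZ_eq_weyl] at hPC
  obtain ⟨A, hA, hAA, hzA, hPA, hAs⟩ := exists_pauli_anticommute hC.1 hP hPP hne hPC
  rw [← pauliZ_eq_weyl] at hPC hzA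
  have hD : controlled P A * C ∈ zInvariantCliffords (insert z s) := by
    refine mem_zInvariantCliffords_insert
      ⟨mul_mem_cliffords (controlled_mem_cliffords hP hA hPP hAA hPA) hC.1,
        mul_mem (controlled_mem _ hPs ?_) hC.2⟩ ?_
    · exact mem_centralizer_pauliZ.2 fun w hw => hAs w (mem_centralizer_pauliZ.1 hC.2 w hw)
    · have hV := mul_controlled_mul hPP hPA hPz hzA
      calc pauliZ z * (controlled P A * C)
          = pauliZ z * controlled P A * (P * P) * C := by rw [hPP, mul_one, mul_assoc]
        _ = controlled P A * (pauliZ z * P) * C := by rw [← mul_assoc _ P, hV]; noncomm_ring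
        _ = controlled P A * P * (pauliZ z * C) := by rw [hPz]; noncomm_ring
        _ = controlled P A * (P * P) * C * pauliZ z := by rw [hPC]; noncomm_ring
        _ = controlled P A * C * pauliZ z := by rw [hPP, mul_one]
  have hPD : P * (controlled P A * C) ∈ zInvariantCliffords (insert z s) := by
    refine ⟨mul_mem_cliffords (pauli_involution_mem_cliffords hP hPP) hD.1, mul_mem ?_ hD.2⟩
    rw [mem_centralizer_pauliZ] at hPs ⊢
    rintro w (rfl | hw)
    exacts [hPz, hPs w hw]
  rw [hsum, ← one_add_mul_controlled hPP A, mul_assoc, add_mul, one_mul, smul_add]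
  refine decompositionBall_subset_of_le (le_of_eq ?_)
    (add_mem_decompositionBall (smul_mem_decompositionBall hD (c / 2))
      (smul_mem_decompositionBall hPD (c / 2)))
  rw [norm_div, Complex.norm_two, add_halves]

theorem symmAverage_pauliZChannel_mem [NeZero n] (hC : C ∈ zInvariantCliffords s) (c : ℂ) :
    symmAverage (pauliZChannel z) (c • C) ∈
      decompositionBall (zInvariantCliffords (insert z s)) ‖c‖ := by
  have hCC := cliffords_conjTranspose_mul_self hC.1
  have hzz := pauliZ_mul_self z
  set P := pauliZ z * (C * pauliZ z * Cᴴ) with hP_def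
  have hP : P ∈ pauliGroup n := mul_mem (pauliZ_mem_pauliGroup z)
    (cliffords_conj_mem_pauliGroup hC.1 _ (pauliZ_mem_pauliGroup z))
  have hPs : P ∈ Subalgebra.centralizer ℂ (pauliZ '' s) := by
    have hz : pauliZ z ∈ Subalgebra.centralizer ℂ (pauliZ '' s) :=
      mem_centralizer_pauliZ.2 fun w _ => pauliZ_mul_comm w z
    exact mul_mem hz (mul_mem (mul_mem hC.2 hz) (conjTranspose_mem_centralizer_pauliZ hC.2))
  have hPC : pauliZ z * C = P * C * pauliZ z := by
    calc pauliZ z * C = pauliZ z * C * pauliZ z * (Cᴴ * C) * pauliZ z := by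
          rw [hCC, mul_one, mul_assoc _ (pauliZ z), hzz, mul_one]
      _ = P * C * pauliZ z := by rw [hP_def]; noncomm_ring
  have hPzP : pauliZ z * P * (pauliZ z * P) = 1 := by
    have hconj : pauliZ z * P = C * pauliZ z * Cᴴ := by rw [hP_def, ← mul_assoc, hzz, one_mul]
    calc _ = C * pauliZ z * (Cᴴ * C) * pauliZ z * Cᴴ := by rw [hconj]; noncomm_ring
      _ = 1 := by
        rw [hCC, mul_one, mul_assoc C, hzz, mul_one, cliffords_mul_conjTranspose_self hC.1]
  have hzP : pauliZ z * P = P * pauliZ z * (P * P) := by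
    calc pauliZ z * P = pauliZ z * (pauliZ z * P * (pauliZ z * P)) * P := by rw [hPzP, mul_one]
      _ = pauliZ z * pauliZ z * (P * pauliZ z * (P * P)) := by noncomm_ring
      _ = P * pauliZ z * (P * P) := by rw [hzz, one_mul]
  rcases pauliGroup_mul_self_eq hP with hPP | hPP
  · rw [hPP, mul_one] at hzP
    exact symmAverage_pauliZChannel_mem_of_mul_self_eq_one hC hP hPs hPC hzP hPP c
  · rw [hPP, mul_neg_one] at hzP
    exact symmAverage_pauliZChannel_mem_of_mul_self_eq_neg_one hC hP hPs hPC hzP hPP c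

end UnitarySymmetrization

section AntiunitarySymmetrization

open scoped Matrix

variable {n : ℕ} {s : Set (Fin n → ZMod 2)} {z : Fin n → ZMod 2} {C D P : QMat n}

/-- The antiunitary symmetry `M ↦ (Z(z) M Z(z)†)^*`. -/
noncomputable def conjPauliZ (z : Fin n → ZMod 2) : QMat n ≃ₗ[ℝ] QMat n :=
  conjMap n * pauliZChannel z

@[simp] theorem conjMap_pauliZ (w : Fin n → ZMod 2) : conjMap n (pauliZ w) = pauliZ w := by
  rw [pauliZ_eq_weyl, conjMap_weyl]

theorem conjMap_conjMap (M : QMat n) : conjMap n (conjMap n M) = M := by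
  ext x y
  simp [conjMap_apply]

theorem pauliZChannel_mul_pauliZChannel (z w : Fin n → ZMod 2) :
    pauliZChannel z * pauliZChannel w = pauliZChannel (z + w) := by
  ext1 M
  rw [LinearEquiv.mul_apply, pauliZChannel_apply, pauliZChannel_apply, pauliZChannel_apply,
    pauliZ_add]
  simp only [mul_assoc, pauliZ_mul_comm w z]

theorem pauliZChannel_mul_conjMap (z : Fin n → ZMod 2) :
    pauliZChannel z * conjMap n = conjMap n * pauliZChannel z := by
  ext1 M
  rw [LinearEquiv.mul_apply, LinearEquiv.mul_apply, pauliZChannel_apply, pauliZChannel_apply,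
    conjMap_mul, conjMap_mul, conjMap_pauliZ]

theorem conjPauliZ_mul_conjPauliZ (z w : Fin n → ZMod 2) :
    conjPauliZ z * conjPauliZ w = pauliZChannel (z + w) := by
  have conjMap_mul_self : conjMap n * conjMap n = 1 := LinearEquiv.ext conjMap_conjMap
  calc conjPauliZ z * conjPauliZ w
      = conjMap n * (pauliZChannel z * conjMap n) * pauliZChannel w := by
        rw [conjPauliZ, conjPauliZ]
        group
    _ = pauliZChannel (z + w) := by
        rw [pauliZChannel_mul_conjMap, ← mul_assoc, conjMap_mul_self, one_mul,
          pauliZChannel_mul_pauliZChannel]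

theorem conjPauliZ_apply (z : Fin n → ZMod 2) (M : QMat n) :
    conjPauliZ z M = pauliZ z * conjMap n M * pauliZ z := by
  change conjMap n (pauliZChannel z M) = _
  rw [pauliZChannel_apply, conjMap_mul, conjMap_mul, conjMap_pauliZ]

theorem conjPauliZ_mul (z : Fin n → ZMod 2) (M N : QMat n) :
    conjPauliZ z (M * N) = conjPauliZ z M * conjPauliZ z N := by
  calc conjPauliZ z (M * N) = pauliZ z * conjMap n M * 1 * conjMap n N * pauliZ z := by
        rw [conjPauliZ_apply, conjMap_mul, mul_one]
        noncomm_ring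
    _ = conjPauliZ z M * conjPauliZ z N := by
        rw [← pauliZ_mul_self z, conjPauliZ_apply, conjPauliZ_apply]
        noncomm_ring

theorem conjPauliZ_smul (z : Fin n → ZMod 2) (c : ℂ) (M : QMat n) :
    conjPauliZ z (c • M) = (starRingEnd ℂ) c • conjPauliZ z M := by
  rw [conjPauliZ_apply, conjPauliZ_apply, conjMap_smul, mul_smul_comm, smul_mul_assoc]

@[simp] theorem conjPauliZ_one (z : Fin n → ZMod 2) : conjPauliZ z 1 = 1 := by
  rw [conjPauliZ_apply, conjMap_one, mul_one, pauliZ_mul_self]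

theorem conjPauliZ_pauliZ (z w : Fin n → ZMod 2) : conjPauliZ z (pauliZ w) = pauliZ w := by
  rw [conjPauliZ_apply, conjMap_pauliZ, pauliZ_mul_comm, mul_assoc, pauliZ_mul_self, mul_one]

theorem conjPauliZ_conjPauliZ (z : Fin n → ZMod 2) (M : QMat n) :
    conjPauliZ z (conjPauliZ z M) = M := by
  rw [← LinearEquiv.mul_apply, conjPauliZ_mul_conjPauliZ, bits_add_self, pauliZChannel_apply,
    pauliZ_zero, one_mul, mul_one]

theorem conjPauliZ_mul_conjTranspose_mem_pauliGroup (z : Fin n → ZMod 2) (hC : C ∈ cliffords n) :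
    conjPauliZ z C * Cᴴ ∈ pauliGroup n := by
  have hz := pauliZ_mem_pauliGroup z
  have h : conjPauliZ z C * Cᴴ = pauliZ z * (conjMap n C * Cᴴ) * (C * pauliZ z * Cᴴ) := by
    calc conjPauliZ z C * Cᴴ = pauliZ z * conjMap n C * 1 * pauliZ z * Cᴴ := by
          rw [conjPauliZ_apply, mul_one]
      _ = _ := by
          rw [← cliffords_conjTranspose_mul_self hC]
          noncomm_ring
  rw [h]
  exact mul_mem (mul_mem hz (conjMap_mul_conjTranspose_mem_pauliGroup hC))
    (cliffords_conj_mem_pauliGroup hC _ hz)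

theorem conjPauliZ_mem_centralizer_pauliZ (hC : C ∈ Subalgebra.centralizer ℂ (pauliZ '' s)) :
    conjPauliZ z C ∈ Subalgebra.centralizer ℂ (pauliZ '' s) := by
  rw [mem_centralizer_pauliZ] at hC ⊢
  intro w hw
  simpa only [conjPauliZ_mul, conjPauliZ_pauliZ] using congrArg (conjPauliZ z) (hC w hw)

theorem exists_smul_conjPauliZ_involution [NeZero n] (z : Fin n → ZMod 2) (hC : C ∈ cliffords n) :
    ∃ μ : ℂ, ‖μ‖ = 1 ∧ μ • C ∈ cliffords n ∧
      conjPauliZ z (μ • C) * (μ • C)ᴴ * (conjPauliZ z (μ • C) * (μ • C)ᴴ) = 1 := by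
  rcases pauliGroup_mul_self_eq (conjPauliZ_mul_conjTranspose_mem_pauliGroup z hC) with h | h
  · exact ⟨1, norm_one, by rwa [one_smul], by rw [one_smul, h]⟩
  · refine ⟨omegaEight, norm_omegaEight, omegaEight_smul_mem_cliffords hC, ?_⟩
    have hI : (starRingEnd ℂ) omegaEight * (starRingEnd ℂ) omegaEight = -Complex.I := by
      rw [← map_mul, ← sq, omegaEight_sq, Complex.conj_I]
    rw [conjPauliZ_smul, Matrix.conjTranspose_smul, Complex.star_def, smul_mul_smul_comm, hI,
      smul_mul_smul_comm, h, neg_mul_neg, Complex.I_mul_I, neg_one_smul, neg_neg]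

theorem conjPauliZ_involutionRoot (hPP : P * P = 1) (hP : conjPauliZ z P = P) :
    conjPauliZ z (involutionRoot P) = involutionRoot P * P := by
  rw [involutionRoot_mul hPP, involutionRoot, map_add, conjPauliZ_smul, conjPauliZ_smul, hP,
    conjPauliZ_one]
  simp [sub_eq_add_neg, map_ofNat]

theorem norm_half_re_add_im_add_norm_half_re_sub_im_le (c : ℂ) :
    ‖(((c.re + c.im) / 2 : ℝ) : ℂ)‖ + ‖(((c.re - c.im) / 2 : ℝ) : ℂ)‖ ≤ ‖c‖ := by
  have hre := abs_le.1 (Complex.abs_re_le_norm c)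
  have him := abs_le.1 (Complex.abs_im_le_norm c)
  rw [Complex.norm_real, Complex.norm_real, Real.norm_eq_abs, Real.norm_eq_abs]
  rcases abs_cases ((c.re + c.im) / 2) with h | h <;>
    rcases abs_cases ((c.re - c.im) / 2) with h' | h' <;> linarith

theorem symmAverage_conjPauliZ_smul (hPP : P * P = 1) (hD : conjPauliZ z D = P * D) (c : ℂ) :
    symmAverage (conjPauliZ z) (c • D) =
      (((c.re + c.im) / 2 : ℝ) : ℂ) • (involutionRoot P * D) +
        (((c.re - c.im) / 2 : ℝ) : ℂ) • (involutionRoot P * P * D) := by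
  have hc := Complex.re_add_im c
  have hc' : (starRingEnd ℂ) c = c.re - c.im * Complex.I := Complex.ext (by simp) (by simp)
  rw [symmAverage_apply, conjPauliZ_smul, hD, hc', involutionRoot_mul hPP, involutionRoot]
  simp only [add_mul, smul_mul_assoc, one_mul]
  match_scalars
  · linear_combination -(1 / 2 : ℂ) * hc
  · ring

theorem symmAverage_conjPauliZ_mem_of_involution [NeZero n] (hD : D ∈ zInvariantCliffords s)
    (hPP : conjPauliZ z D * Dᴴ * (conjPauliZ z D * Dᴴ) = 1) (c : ℂ) :
    symmAverage (conjPauliZ z) (c • D) ∈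
      decompositionBall {E ∈ zInvariantCliffords s | conjPauliZ z E = E} ‖c‖ := by
  have hP : conjPauliZ z D * Dᴴ ∈ pauliGroup n :=
    conjPauliZ_mul_conjTranspose_mem_pauliGroup z hD.1
  have hPs : conjPauliZ z D * Dᴴ ∈ Subalgebra.centralizer ℂ (pauliZ '' s) :=
    mul_mem (conjPauliZ_mem_centralizer_pauliZ hD.2) (conjTranspose_mem_centralizer_pauliZ hD.2)
  have hPD : conjPauliZ z D = conjPauliZ z D * Dᴴ * D := by
    rw [mul_assoc, cliffords_conjTranspose_mul_self hD.1, mul_one]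
  generalize conjPauliZ z D * Dᴴ = P at hPP hP hPs hPD
  have hzP : conjPauliZ z P = P := by
    have hPP' : conjPauliZ z P * P = 1 := by
      refine (IsUnit.of_mul_eq_one _ (cliffords_mul_conjTranspose_self hD.1)).mul_eq_right.1 ?_
      rw [mul_assoc, ← hPD, ← conjPauliZ_mul, ← hPD, conjPauliZ_conjPauliZ]
    exact left_inv_eq_right_inv hPP' hPP
  have hroot := conjPauliZ_involutionRoot hPP hzP
  have hroot_cliff := involutionRoot_mem_cliffords hP hPP
  have hrootD : involutionRoot P * D ∈ {E ∈ zInvariantCliffords s | conjPauliZ z E = E} := by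
    refine ⟨⟨mul_mem_cliffords hroot_cliff hD.1, mul_mem (involutionRoot_mem _ hPs) hD.2⟩, ?_⟩
    rw [conjPauliZ_mul, hroot, hPD, mul_assoc, ← mul_assoc P, hPP, one_mul]
  have hrootPD : involutionRoot P * P * D ∈ {E ∈ zInvariantCliffords s | conjPauliZ z E = E} := by
    refine ⟨⟨mul_mem_cliffords (mul_mem_cliffords hroot_cliff
      (pauli_involution_mem_cliffords hP hPP)) hD.1,
      mul_mem (mul_mem (involutionRoot_mem _ hPs) hPs) hD.2⟩, ?_⟩
    rw [conjPauliZ_mul, conjPauliZ_mul, hroot, hPD, hzP, mul_assoc _ P P, hPP, mul_one, mul_assoc]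
  rw [symmAverage_conjPauliZ_smul hPP hPD]
  refine decompositionBall_subset_of_le (norm_half_re_add_im_add_norm_half_re_sub_im_le c)
    (add_mem_decompositionBall (smul_mem_decompositionBall hrootD _)
      (smul_mem_decompositionBall hrootPD _))

theorem symmAverage_conjPauliZ_mem [NeZero n] (hC : C ∈ zInvariantCliffords s) (c : ℂ) :
    symmAverage (conjPauliZ z) (c • C) ∈
      decompositionBall {E ∈ zInvariantCliffords s | conjPauliZ z E = E} ‖c‖ := by
  obtain ⟨μ, hμ, hμC, hPP⟩ := exists_smul_conjPauliZ_involution z hC.1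
  have hμμ : (starRingEnd ℂ) μ * μ = 1 := by
    rw [Complex.conj_mul', hμ, Complex.ofReal_one, one_pow]
  have h := symmAverage_conjPauliZ_mem_of_involution ⟨hμC, Subalgebra.smul_mem _ hC.2 μ⟩ hPP
    (c * (starRingEnd ℂ) μ)
  rwa [smul_smul, mul_assoc, hμμ, mul_one, norm_mul, RCLike.norm_conj, hμ, mul_one] at h

end AntiunitarySymmetrization

section SpanningAndFiniteness

open scoped Matrix

variable {n : ℕ} {C D : QMat n}

theorem sum_signChar_dotProduct (w : Fin n → ZMod 2) :
    ∑ b, signChar (b ⬝ᵥ w) = if w = 0 then 2 ^ n else 0 := by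
  split_ifs with h
  · subst h
    simp
  · obtain ⟨j, hj⟩ := Function.ne_iff.1 h
    have hj1 : w j = 1 := (zmod_two_eq_zero_or_one _).resolve_left hj
    have flip := Equiv.sum_comp (Equiv.addRight (Pi.single j 1 : Fin n → ZMod 2))
      fun b => signChar (b ⬝ᵥ w)
    simp only [Equiv.coe_addRight, add_dotProduct, single_dotProduct, hj1, one_mul,
      AddChar.map_add_eq_mul, signChar_one, mul_neg_one, Finset.sum_neg_distrib] at flip
    linear_combination -(1 / 2 : ℂ) * flip

theorem single_eq_sum_weyl (x y : Fin n → ZMod 2) (t : ℂ) :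
    (Matrix.single x y t : QMat n) =
      ∑ b, (t * (2 ^ n)⁻¹ * signChar (b ⬝ᵥ y)) • weyl (x + y) b := by
  ext u v
  have add_add_cancel (y : Fin n → ZMod 2) : y + (x + y) = x := by
    rw [add_left_comm, bits_add_self, add_zero]
  have hyv : y + v = 0 ↔ y = v := by
    rw [add_eq_zero_iff_eq_neg, ← eq_neg_of_add_eq_zero_left (bits_add_self v)]
  simp only [Matrix.sum_apply, Matrix.smul_apply, smul_eq_mul, weyl, Matrix.of_apply, mul_ite,
    mul_zero, Matrix.single_apply]
  by_cases hu : u = v + (x + y)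
  · simp only [hu, if_true, mul_assoc, ← AddChar.map_add_eq_mul, ← dotProduct_add,
      ← Finset.mul_sum, sum_signChar_dotProduct, hyv]
    rcases eq_or_ne y v with rfl | hy
    · simp [add_add_cancel]
    · simp [hy]
  · simp only [hu, if_false, Finset.sum_const_zero]
    exact if_neg fun ⟨hxu, hyv⟩ => hu (by rw [← hxu, ← hyv, add_add_cancel])

theorem exists_smul_weyl_mem_cliffords (a b : Fin n → ZMod 2) :
    ∃ c : ℂ, c ≠ 0 ∧ c • weyl a b ∈ cliffords n := by
  obtain rfl | hn := eq_or_ne n 0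
  · refine ⟨1, one_ne_zero, ?_⟩
    rw [Subsingleton.elim a 0, Subsingleton.elim b 0, weyl_zero, one_smul]
    exact one_mem_cliffords 0
  · have : NeZero n := ⟨hn⟩
    obtain ⟨c, hc, hsq⟩ := exists_smul_mul_self_eq_one (weyl_mem_pauliGroup a b)
    exact ⟨c, by rintro rfl; simp at hc,
      pauli_involution_mem_cliffords (smul_mem_pauliGroup hc (weyl_mem_pauliGroup a b)) hsq⟩

theorem span_cliffords (n : ℕ) : Submodule.span ℂ (cliffords n) = ⊤ := by
  have weyl_mem (a b : Fin n → ZMod 2) : weyl a b ∈ Submodule.span ℂ (cliffords n) := by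
    obtain ⟨c, hc, h⟩ := exists_smul_weyl_mem_cliffords a b
    exact (Submodule.smul_mem_iff _ hc).1 (Submodule.subset_span h)
  refine Submodule.eq_top_iff'.2 fun M => ?_
  rw [Matrix.matrix_eq_sum_single M]
  simp only [single_eq_sum_weyl]
  exact sum_mem fun x _ => sum_mem fun y _ => sum_mem fun b _ =>
    Submodule.smul_mem _ _ (weyl_mem _ _)

theorem exists_isDecomposition_cliffords (M : QMat n) :
    ∃ x : cliffords n →₀ ℂ, IsDecomposition x M := by
  have hM : M ∈ Submodule.span ℂ (Set.range ((↑) : cliffords n → QMat n)) := by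
    rw [Subtype.range_coe, span_cliffords]
    exact Submodule.mem_top
  obtain ⟨x, hx⟩ := Finsupp.mem_span_range_iff_exists_finsupp.1 hM
  exact ⟨x, hx.symm⟩

theorem exists_eq_smul_one_of_commute_weyl {M : QMat n} (h : ∀ a b, Commute (weyl a b) M) :
    ∃ c : ℂ, M = c • 1 := by
  obtain ⟨c, rfl⟩ : M ∈ Set.range (Matrix.scalar (Fin n → ZMod 2)) :=
    Matrix.mem_range_scalar_of_commute_single fun x y _ => by
      change Commute (Matrix.single x y 1) M
      rw [single_eq_sum_weyl]
      exact Commute.sum_left _ _ _ fun b _ => (h _ b).smul_left _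
  exact ⟨c, by rw [Matrix.scalar_apply, Matrix.smul_one_eq_diagonal]⟩

theorem finite_setOf_pow_eq_one {R : Type*} [CommRing R] [IsDomain R] {m : ℕ} (hm : 0 < m) :
    {c : R | c ^ m = 1}.Finite := by
  classical
  exact (Polynomial.nthRoots m (1 : R)).toFinset.finite_toSet.subset fun c hc => by
    simpa [Polynomial.mem_nthRoots hm] using hc

theorem finite_pauliGroup (n : ℕ) : (pauliGroup n : Set (QMat n)).Finite := by
  have hlabels := (finite_setOf_pow_eq_one (R := ℂ) four_pos).prod
    (Set.finite_univ (α := (Fin n → ZMod 2) × (Fin n → ZMod 2)))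
  refine (hlabels.image fun p => p.1 • weyl p.2.1 p.2.2).subset ?_
  rintro _ ⟨c, a, b, hc, rfl⟩
  exact ⟨(c, a, b), ⟨hc, trivial⟩, rfl⟩

theorem exists_eq_smul_of_conj_weyl_eq (hC : C ∈ cliffords n) (hD : D ∈ cliffords n)
    (h : ∀ a b, D * weyl a b * Dᴴ = C * weyl a b * Cᴴ) :
    ∃ c : ℂ, c ^ (Fintype.card (Fin n → ZMod 2) * 4) = 1 ∧ D = c • C := by
  have hCC := cliffords_conjTranspose_mul_self hC
  have hDD := cliffords_conjTranspose_mul_self hD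
  obtain ⟨c, hc⟩ : ∃ c : ℂ, Cᴴ * D = c • 1 := by
    refine exists_eq_smul_one_of_commute_weyl fun a b => Eq.symm ?_
    calc Cᴴ * D * weyl a b = Cᴴ * (D * weyl a b * Dᴴ) * D := by
          rw [mul_assoc, mul_assoc, mul_assoc _ Dᴴ, hDD, mul_one]
      _ = Cᴴ * C * weyl a b * Cᴴ * D := by rw [h]; noncomm_ring
      _ = weyl a b * (Cᴴ * D) := by rw [hCC, one_mul, mul_assoc]
  have hDc : D = c • C := by
    rw [← one_mul D, ← cliffords_mul_conjTranspose_self hC, mul_assoc, hc, mul_smul_comm, mul_one]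
  have hdet := cliffords_det_pow_four hD
  rw [hDc, Matrix.det_smul, mul_pow, cliffords_det_pow_four hC, mul_one, ← pow_mul] at hdet
  exact ⟨c, hdet, hDc⟩

-- Conjugation maps the finite Pauli group into itself and determines a Clifford unitary up to a
-- scalar, which is a root of unity because the determinants are fourth roots of unity.
theorem finite_cliffords (n : ℕ) : (cliffords n).Finite := by
  refine Set.Finite.of_finite_fibers
    (fun (C : QMat n) (p : (Fin n → ZMod 2) × (Fin n → ZMod 2)) => C * weyl p.1 p.2 * Cᴴ) ?_ ?_
  · refine (Set.Finite.pi' fun _ => finite_pauliGroup n).subset ?_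
    rintro _ ⟨C, hC, rfl⟩ p
    exact cliffords_conj_mem_pauliGroup hC _ (weyl_mem_pauliGroup _ _)
  · rintro _ ⟨C, hC, rfl⟩
    have hm : 0 < Fintype.card (Fin n → ZMod 2) * 4 := by positivity
    refine ((finite_setOf_pow_eq_one hm).image fun c : ℂ => c • C).subset ?_
    rintro D ⟨hD, hDC⟩
    obtain ⟨c, hc, rfl⟩ := exists_eq_smul_of_conj_weyl_eq hC hD fun a b => congrFun hDC (a, b)
    exact ⟨c, hc, rfl⟩

end SpanningAndFiniteness

section SymmetryGroups

variable {n : ℕ} {G : Subgroup (QMat n ≃ₗ[ℝ] QMat n)} {U : QMat n} {r : ℝ}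

theorem conjPauliZ_mul_pauliZChannel (z w : Fin n → ZMod 2) :
    conjPauliZ z * pauliZChannel w = conjPauliZ (z + w) := by
  rw [conjPauliZ, mul_assoc, pauliZChannel_mul_pauliZChannel, conjPauliZ]

theorem pauliZChannel_mul_conjPauliZ (z w : Fin n → ZMod 2) :
    pauliZChannel z * conjPauliZ w = conjPauliZ (z + w) := by
  rw [conjPauliZ, ← mul_assoc, pauliZChannel_mul_conjMap, mul_assoc,
    pauliZChannel_mul_pauliZChannel, conjPauliZ]

theorem pauliZChannel_zero : pauliZChannel (0 : Fin n → ZMod 2) = 1 := by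
  ext1 M
  rw [pauliZChannel_apply, pauliZ_zero, one_mul, mul_one, LinearEquiv.coe_one, id]

theorem pauliZChannel_inv (z : Fin n → ZMod 2) : (pauliZChannel z)⁻¹ = pauliZChannel z :=
  inv_eq_of_mul_eq_one_left (by
    rw [pauliZChannel_mul_pauliZChannel, bits_add_self, pauliZChannel_zero])

theorem conjPauliZ_inv (z : Fin n → ZMod 2) : (conjPauliZ z)⁻¹ = conjPauliZ z :=
  inv_eq_of_mul_eq_one_left (by
    rw [conjPauliZ_mul_conjPauliZ, bits_add_self, pauliZChannel_zero])

theorem eq_pauliZChannel_or_eq_conjPauliZ {φ : QMat n ≃ₗ[ℝ] QMat n}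
    (hφ : φ ∈ conjugationDiagonalPauliGroup n) :
    ∃ z, φ = pauliZChannel z ∨ φ = conjPauliZ z := by
  rw [conjugationDiagonalPauliGroup, conjugationGroup, Subgroup.zpowers_eq_closure,
    ← Subgroup.closure_eq (diagonalPauliGroup n), ← Subgroup.closure_union] at hφ
  induction hφ using Subgroup.closure_induction with
  | mem φ h =>
    rcases h with rfl | ⟨z, rfl⟩
    · exact ⟨0, .inr (by rw [conjPauliZ, pauliZChannel_zero, mul_one])⟩
    · exact ⟨z, .inl rfl⟩
  | one => exact ⟨0, .inl pauliZChannel_zero.symm⟩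
  | mul φ ψ _ _ hφ hψ =>
    obtain ⟨z, rfl | rfl⟩ := hφ <;> obtain ⟨w, rfl | rfl⟩ := hψ
    · exact ⟨z + w, .inl (pauliZChannel_mul_pauliZChannel z w)⟩
    · exact ⟨z + w, .inr (pauliZChannel_mul_conjPauliZ z w)⟩
    · exact ⟨z + w, .inr (conjPauliZ_mul_pauliZChannel z w)⟩
    · exact ⟨z + w, .inl (conjPauliZ_mul_conjPauliZ z w)⟩
  | inv φ _ hφ =>
    obtain ⟨z, rfl | rfl⟩ := hφ
    exacts [⟨z, .inl (pauliZChannel_inv z)⟩, ⟨z, .inr (conjPauliZ_inv z)⟩]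

theorem apply_groupProjection {φ : QMat n ≃ₗ[ℝ] QMat n} (hφ : φ ∈ G) (M : QMat n) :
    φ (groupProjection G M) = groupProjection G M := by
  rcases finite_or_infinite G with hG | hG
  · have := Fintype.ofFinite G
    rw [groupProjection, finsum_eq_sum_of_fintype, map_smul, map_sum]
    congr 1
    exact Equiv.sum_comp (Equiv.mulLeft (⟨φ, hφ⟩ : G)) fun ψ : G => (ψ : QMat n ≃ₗ[ℝ] QMat n) M
  · rw [groupProjection, Nat.card_eq_zero_of_infinite, Nat.cast_zero, inv_zero, zero_smul, map_zero]

theorem mem_decompositionBall_zInvariantCliffords [NeZero n] (s : Set (Fin n → ZMod 2))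
    (hs : ∀ z ∈ s, pauliZChannel z U = U) (hU : U ∈ decompositionBall (cliffords n) r) :
    U ∈ decompositionBall (zInvariantCliffords s) r := by
  induction s, s.toFinite using Set.Finite.induction_on with
  | empty =>
    have subset_empty : cliffords n ⊆ zInvariantCliffords ∅ :=
      fun _ hC => ⟨hC, mem_centralizer_pauliZ.2 fun _ => False.elim⟩
    exact decompositionBall_subset_of_subset subset_empty r hU
  | insert _ _ ih =>
    exact mem_decompositionBall_of_apply_eq (hs _ (Set.mem_insert _ _))
      (fun _ hC => symmAverage_pauliZChannel_mem hC)
      (ih fun z hz => hs z (Set.mem_insert_of_mem _ hz))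

theorem zInvariantCliffords_subset_invariantCliffords (hG : G ≤ diagonalPauliGroup n) :
    zInvariantCliffords {z | pauliZChannel z ∈ G} ⊆ invariantCliffords G := by
  refine fun C hC => ⟨hC.1, fun φ hφ => ?_⟩
  obtain ⟨z, rfl⟩ := hG hφ
  exact pauliZChannel_apply_eq_self_iff.2 (mem_centralizer_pauliZ.1 hC.2 z hφ)

theorem sep_zInvariantCliffords_subset_invariantCliffords
    (hG : G ≤ conjugationDiagonalPauliGroup n) {z : Fin n → ZMod 2} (hz : conjPauliZ z ∈ G) :
    {C ∈ zInvariantCliffords {w | pauliZChannel w ∈ G} | conjPauliZ z C = C} ⊆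
      invariantCliffords G := by
  rintro C ⟨hC, hzC⟩
  have fixed (w) (hw : pauliZChannel w ∈ G) : pauliZChannel w C = C :=
    pauliZChannel_apply_eq_self_iff.2 (mem_centralizer_pauliZ.1 hC.2 w hw)
  refine ⟨hC.1, fun φ hφ => ?_⟩
  obtain ⟨w, rfl | rfl⟩ := eq_pauliZChannel_or_eq_conjPauliZ (hG hφ)
  · exact fixed w hφ
  · calc conjPauliZ w C = (conjPauliZ w * conjPauliZ z) C := by rw [LinearEquiv.mul_apply, hzC]
      _ = C := by
        have hwz := mul_mem hφ hz
        rw [conjPauliZ_mul_conjPauliZ] at hwz ⊢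
        exact fixed _ hwz

theorem cliffords_zero_subset_invariantCliffords {G : Subgroup (QMat 0 ≃ₗ[ℝ] QMat 0)}
    (hG : G ≤ conjugationDiagonalPauliGroup 0) : cliffords 0 ⊆ invariantCliffords G := by
  refine fun C hC => ⟨hC, fun φ hφ => ?_⟩
  rw [cliffords_zero, Set.mem_singleton_iff] at hC
  obtain ⟨z, rfl | rfl⟩ := eq_pauliZChannel_or_eq_conjPauliZ (hG hφ)
  · rw [hC, pauliZChannel_apply, mul_one, pauliZ_mul_self]
  · rw [hC, conjPauliZ_one]

theorem mem_decompositionBall_invariantCliffords (hG : G ≤ conjugationDiagonalPauliGroup n)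
    (hGU : ∀ φ ∈ G, φ U = U) (hU : U ∈ decompositionBall (cliffords n) r) :
    U ∈ decompositionBall (invariantCliffords G) r := by
  obtain rfl | hn := eq_or_ne n 0
  · exact decompositionBall_subset_of_subset (cliffords_zero_subset_invariantCliffords hG) r hU
  have : NeZero n := ⟨hn⟩
  have hUz := mem_decompositionBall_zInvariantCliffords {z | pauliZChannel z ∈ G}
    (fun _ hz => hGU _ hz) hU
  by_cases h : ∃ z, conjPauliZ z ∈ G
  · obtain ⟨z, hz⟩ := h
    exact decompositionBall_subset_of_subset
      (sep_zInvariantCliffords_subset_invariantCliffords hG hz) r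
      (mem_decompositionBall_of_apply_eq (hGU _ hz) (fun _ hC => symmAverage_conjPauliZ_mem hC) hUz)
  · have hG' : G ≤ diagonalPauliGroup n := fun φ hφ => by
      obtain ⟨z, rfl | rfl⟩ := eq_pauliZChannel_or_eq_conjPauliZ (hG hφ)
      exacts [⟨z, rfl⟩, absurd ⟨z, hφ⟩ h]
    exact decompositionBall_subset_of_subset
      (zInvariantCliffords_subset_invariantCliffords hG') r hUz

end SymmetryGroups

theorem theorem1_general (n : ℕ) (G : Subgroup (QMat n ≃ₗ[ℝ] QMat n))
    (hG : G ≤ conjugationDiagonalPauliGroup n) (U : QMat n) (hU : U = groupProjection G U) :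
    IsLeast (costSet (cliffords n) U) (stabilizerExtent U) ∧
      IsLeast (costSet (invariantCliffords G) U) (symmetricExtent G U) ∧
      stabilizerExtent U = symmetricExtent G U ∧
      ∃ x : cliffords n →₀ ℂ, IsDecomposition x U ∧ decompositionCost x = stabilizerExtent U ∧
        ∀ C ∈ x.support, (C : QMat n) ∈ invariantCliffords G := by
  have hGU : ∀ φ ∈ G, φ U = U := fun φ hφ => by rw [hU, apply_groupProjection hφ]
  obtain ⟨m, hm, hmG, hx⟩ := exists_isLeast_costSet_of_decompositionBall (finite_cliffords n)
    (fun _ hC => hC.1) (exists_isDecomposition_cliffords U)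
    fun _ => mem_decompositionBall_invariantCliffords hG hGU
  have hξ : stabilizerExtent U = m := hm.csInf_eq
  have hξG : symmetricExtent G U = m := hmG.csInf_eq
  rw [hξ, hξG]
  exact ⟨hm, hmG, rfl, hx⟩

/-- For `G ∈ {K_n, Z_n, K_n × Z_n}` and every `G`-invariant `U`: both minima exist, they agree, and
an optimal Clifford decomposition of `U` can be chosen with `G`-invariant Cliffords only. -/
theorem theorem1 (n : ℕ) (G : Subgroup (QMat n ≃ₗ[ℝ] QMat n))
    (hG : G = conjugationGroup n ∨ G = diagonalPauliGroup n ∨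
      G = conjugationDiagonalPauliGroup n)
    (U : QMat n) (hU : U = groupProjection G U) :
    IsLeast (costSet (cliffords n) U) (stabilizerExtent U) ∧
      IsLeast (costSet (invariantCliffords G) U) (symmetricExtent G U) ∧
      stabilizerExtent U = symmetricExtent G U ∧
      ∃ x : cliffords n →₀ ℂ, IsDecomposition x U ∧ decompositionCost x = stabilizerExtent U ∧
        ∀ C ∈ x.support, (C : QMat n) ∈ invariantCliffords G := by
  have hG' : G ≤ conjugationDiagonalPauliGroup n := by
    rcases hG with rfl | rfl | rfl; exacts [le_sup_left, le_sup_right, le_rfl]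
  exact theorem1_general n G hG' U hU
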